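/- **Setting.** Let $M,A\in\mathbb N$ with $M\ge 3$ and $1<A<M$, and put $\delta=\log A/\log M\in(0,1)$. Let $\mathbf A(M,A)$ be the set of all alphabets $\mathcal A\subset\{0,\dots,M-1\}$ with $|\mathcal A|=A$, with the uniform probability measure $\mu(\Omega)=|\Omega|/\binom MA$ and the corresponding expectation $\mathbb E$. Let $\mathcal F_N u(j)=N^{-1/2}\sum_{l=0}^{N-1}e^{-2\pi i jl/N}u(l)$ be the unitary discrete Fourier transform on $\ell^2_N=\mathbb C^{\{0,\dots,N-1\}}$. A cutoff function is a function $\chi\in C_c^\infty((0,1);[0,1])$, and $\chi_n$ denotes multiplication by $\chi(j/n)$ on $\ell^2_n$. For $N=M^k$ with $k\ge 1$, the open quantum map associated with $(M,\mathcal A,\chi)$ is $$B_N=B_{N,\mathcal A,\chi}=\mathcal F_N^{-1}\,\mathrm{diag}(D_0,\dots,D_{M-1}),\qquad D_a=\begin{cases}\chi_{N/M}\mathcal F_{N/M}\chi_{N/M}, & a\in\mathcal A,\\ 0, & a\notin\mathcal A,\end{cases}$$ a block diagonal matrix with $M$ blocks of size $N/M$, composed with $\mathcal F_N^{-1}$.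 We say that $B_N$ has a spectral gap of $\beta\in\mathbb R$ if $$\limsup_{N=M^k,\ k\to\infty}\ \max\{|\lambda|:\lambda\in\mathrm{Sp}(B_N)\}\le M^{-\beta}.$$ The spectral gap $\beta_{\mathrm{gap}}(M,\mathcal A,\chi)\in[0,\infty]$ is the supremum of all such $\beta$. **Corollary.** (i) Suppose $\delta\in(0,2/3)$ and let $\varepsilon>0$. Then there is a set $\mathcal G\subset\mathbf A(M,A)$ with $$\mu\big(\mathbf A(M,A)\setminus\mathcal G\big)\le 4M e^{-M^{4\varepsilon}/64}$$ such that for all $\mathcal A\in\mathcal G$ and all cutoff functions $\chi$, the open quantum map $B_N$ has a spectral gap of (at least) $\frac12-\frac34\delta-\varepsilon$. (ii) There is a function $o:\mathbb N\to\mathbb R$ with $o(M)\to0$ as $M\to\infty$ such that for all $M\ge3$ and $A$ with $\delta=\log A/\log M\in(0,1)$, and all choices of cutoff functions $\chi_{\mathcal A}$, $\mathcal A\in\mathbf A(M,A)$ (for instance one fixed $\chi$), $$\mathbb E\big(\beta_{\mathrm{gap}}(M,\mathcal A,\chi_{\mathcal A})\big)\ge\max\Big\{0,\ \frac12-\frac34\delta+o(M)\Big\}.$$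 -/

import Mathlib

open Filter Topology
open scoped ContDiff

noncomputable section

/-- The dimension `δ = log A / log M`, that is, `A = M ^ δ`. -/
def dimension (M A : ℕ) : ℝ := Real.log A / Real.log M

/-- The space of alphabets: subsets of `{0, …, M - 1}` of cardinality `A`. -/
def alphabets (M A : ℕ) : Finset (Finset (Fin M)) :=
  Finset.powersetCard A Finset.univ

/-- The uniform counting probability of a set `Ω` of alphabets (for `Ω ⊆ alphabets M A`). -/
def alphabetProb (M A : ℕ) (Ω : Finset (Finset (Fin M))) : ℝ :=
  (Ω.card : ℝ) / ((alphabets M A).card : ℝ)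

/-- The expectation, for the uniform counting probability, of an extended real valued function
on the space of alphabets. -/
def alphabetExpectation (M A : ℕ) (X : Finset (Fin M) → EReal) : EReal :=
  (∑ 𝒜 ∈ alphabets M A, X 𝒜) / (((alphabets M A).card : ℝ) : EReal)

/-- The unitary discrete Fourier transform on `l²_N`. -/
def dftMatrix (N : ℕ) : Matrix (Fin N) (Fin N) ℂ :=
  Matrix.of fun j l =>
    (1 / (Real.sqrt N : ℂ)) *
      Complex.exp (-(2 * Real.pi * Complex.I * (j : ℕ) * (l : ℕ)) / (N : ℂ))

/-- Cutoff functions: smooth functions with values in `[0, 1]` and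
(necessarily compact) support contained in the open interval `(0, 1)`. -/
structure IsCutoff (χ : ℝ → ℝ) : Prop where
  smooth : ContDiff ℝ ∞ χ
  tsupport_subset : tsupport χ ⊆ Set.Ioo 0 1
  mem_Icc : ∀ x, χ x ∈ Set.Icc (0 : ℝ) 1

/-- The discretization `χ_n` of `χ`: multiplication by `χ (j / n)` on `l²_n`. -/
def cutoffMatrix (χ : ℝ → ℝ) (n : ℕ) : Matrix (Fin n) (Fin n) ℂ :=
  Matrix.diagonal fun j => ((χ (((j : ℕ) : ℝ) / (n : ℝ)) : ℝ) : ℂ)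

/-- The position `n * a + b` in `{0, …, M * n - 1}` of the `b`-th index of the `a`-th of `M`
consecutive blocks of length `n`. -/
def blockIndex (M n : ℕ) : Fin n × Fin M ≃ Fin (M * n) :=
  (Equiv.prodComm (Fin n) (Fin M)).trans finProdFinEquiv

/-- The open quantum (baker's) map `B_N` with `N = M * n`: the inverse Fourier transform
`F_N⁻¹` composed with the block diagonal matrix whose `a`-th block, `a = 0, …, M - 1`, is
`χ_n F_n χ_n` if `a ∈ 𝒜` and zero otherwise. -/
def openQuantumMap (M n : ℕ) (𝒜 : Finset (Fin M)) (χ : ℝ → ℝ) :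
    Matrix (Fin (M * n)) (Fin (M * n)) ℂ :=
  (dftMatrix (M * n))⁻¹ *
    Matrix.reindex (blockIndex M n) (blockIndex M n)
      (Matrix.blockDiagonal fun a : Fin M =>
        if a ∈ 𝒜 then cutoffMatrix χ n * dftMatrix n * cutoffMatrix χ n else 0)

/-- The open quantum maps `B_N` have a spectral gap of `β`:
`limsup max {|λ| : λ ∈ Sp (B_N)} ≤ M ^ (-β)` as `N → ∞` along the powers `N = M * M ^ k` of `M`. -/
def HasSpectralGap (M : ℕ) (𝒜 : Finset (Fin M)) (χ : ℝ → ℝ) (β : ℝ) : Prop :=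
  limsup (fun k : ℕ => spectralRadius ℂ (openQuantumMap M (M ^ k) 𝒜 χ)) atTop
    ≤ ENNReal.ofReal ((M : ℝ) ^ (-β))

/-- The spectral gap: the supremum of all `β` such that there is a spectral gap of `β`.
It is `⊤` exactly when the limsup of the spectral radii vanishes. -/
def spectralGap (M : ℕ) (𝒜 : Finset (Fin M)) (χ : ℝ → ℝ) : EReal :=
  sSup {x : EReal | ∃ β : ℝ, HasSpectralGap M 𝒜 χ β ∧ x = (β : EReal)}

end

/-! The spectral radius is controlled by a fractal uncertainty principle, and for most alphabets
that principle holds with the required exponent.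

Deterministic part. Up to rapidly decaying entries, `B_N` lives on the graph of `l ↦ M l mod N` over
the blocks in `𝒜` (`IsCutoff.exists_norm_openQuantumMap_le`). Iterating `B u = z u`, an eigenvector
`u` keeps mass at least about `|z|^m` near the base-`M` Cantor set with digits in `𝒜`. Since `Bᵀ F =
F B`, the vector `F u` is an eigenvector of `Bᵀ`, and its mass off the same neighbourhood is about
`|z|^(-m)` times a negligible error. Hence `|z|^m` is essentially at most the norm of the Fourier
transform cut off on both sides to that neighbourhood (`eigenvalue_bound`). The neighbourhood is a
union of few translates of the Cantor set (`FourierBound.of_covering`), and on the Cantor set the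
norm is submultiplicative in the number of digits (`FourierBound.pow`). So a bound `r` for the
single alphabet, in dimension `M`, gives a limiting spectral radius at most `r`
(`IsCutoff.hasSpectralGap_of_fourierBound`).

Probabilistic part. If every nontrivial Fourier coefficient of `1_𝒜` is at most `t`, then `T T*`
gives `r² = (A + t A) / M`. For a random alphabet square-root cancellation allows `t` of size `√A
M^(2ε)`, so `r = M^(-(1/2 - 3δ/4 - ε))`. The exceptional probability comes from a Chernoff bound for
sampling without replacement and a union bound over frequencies. For the expectation, `ε` tends to
zero slowly with `M`, and exceptional alphabets contribute at least `0`. -/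

/-! ### Digit Cantor sets and submultiplicativity of the Fourier bound -/

/-- The kernel of the unitary discrete Fourier transform, extended to all integers. -/
noncomputable def fourierKernel (N : ℕ) (j l : ℤ) : ℂ :=
  (1 / (Real.sqrt N : ℂ)) * Complex.exp (-(2 * Real.pi * Complex.I * j * l) / (N : ℂ))

/-- The Fourier transform on `ℤ / N`, restricted to functions on `Y` and evaluated on `X`, has
operator norm at most `r`. -/
def FourierBound (N : ℕ) (X Y : Finset ℤ) (r : ℝ) : Prop :=
  ∀ u : ℤ → ℂ, ∑ j ∈ X, ‖∑ l ∈ Y, fourierKernel N j l * u l‖ ^ 2 ≤ r ^ 2 * ∑ l ∈ Y, ‖u l‖ ^ 2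

/-- The integers with `k` digits in base `M`, all of them in `𝒜`. -/
def digitCantorSet (M : ℕ) (𝒜 : Finset (Fin M)) : ℕ → Finset ℤ
  | 0 => {0}
  | k + 1 => (𝒜 ×ˢ digitCantorSet M 𝒜 k).image fun p => (p.1 : ℤ) * (M : ℤ) ^ k + p.2

/-- The digits themselves, as integers. -/
def digitSet (M : ℕ) (𝒜 : Finset (Fin M)) : Finset ℤ := 𝒜.image fun a : Fin M => ((a : ℕ) : ℤ)

theorem mem_cantorSet_succ {M : ℕ} {𝒜 : Finset (Fin M)} {k : ℕ} {x : ℤ} :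
    x ∈ digitCantorSet M 𝒜 (k + 1) ↔
      ∃ a ∈ 𝒜, ∃ c ∈ digitCantorSet M 𝒜 k, (a : ℤ) * (M : ℤ) ^ k + c = x := by
  simp only [digitCantorSet, Finset.mem_image, Finset.mem_product, Prod.exists]
  constructor
  · rintro ⟨a, c, ⟨ha, hc⟩, h⟩
    exact ⟨a, ha, c, hc, h⟩
  · rintro ⟨a, ha, c, hc, h⟩
    exact ⟨a, c, ⟨ha, hc⟩, h⟩

theorem cantorSet_bounds {M : ℕ} {𝒜 : Finset (Fin M)} {k : ℕ} :
    ∀ {x : ℤ}, x ∈ digitCantorSet M 𝒜 k → 0 ≤ x ∧ x < (M : ℤ) ^ k := by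
  induction k with
  | zero => intro x hx; simp [digitCantorSet] at hx; simp [hx]
  | succ k ih =>
    intro x hx
    obtain ⟨a, -, c, hc, rfl⟩ := mem_cantorSet_succ.1 hx
    obtain ⟨h0, h1⟩ := ih hc
    have ha : (a : ℤ) + 1 ≤ M := by exact_mod_cast a.2
    have hp : (0 : ℤ) ≤ (M : ℤ) ^ k := by positivity
    refine ⟨by positivity, ?_⟩
    rw [pow_succ]
    nlinarith

theorem cantorSet_nonempty {M : ℕ} {𝒜 : Finset (Fin M)} (h : 𝒜.Nonempty) (k : ℕ) :
    (digitCantorSet M 𝒜 k).Nonempty := by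
  induction k with
  | zero => simp [digitCantorSet]
  | succ k ih => exact (h.product ih).image _

theorem cantorSet_append {M : ℕ} {𝒜 : Finset (Fin M)} {m p : ℕ} {e : ℤ}
    (he : e ∈ digitCantorSet M 𝒜 p) :
    ∀ {c : ℤ}, c ∈ digitCantorSet M 𝒜 m → c * (M : ℤ) ^ p + e ∈ digitCantorSet M 𝒜 (m + p) := by
  induction m with
  | zero => intro c hc; simp [digitCantorSet] at hc; simpa [hc] using he
  | succ m ih =>
    intro c hc
    obtain ⟨a, ha, c', hc', rfl⟩ := mem_cantorSet_succ.1 hc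
    rw [Nat.add_right_comm]
    refine mem_cantorSet_succ.2 ⟨a, ha, _, ih hc', ?_⟩
    rw [pow_add]; ring

/-- The recursive definition peels off the leading digit. The factorization of the Fourier transform
needs the leading digit in one variable and the last digit in the other. -/
theorem exists_last_digit {M : ℕ} {𝒜 : Finset (Fin M)} {k : ℕ} :
    ∀ {x : ℤ}, x ∈ digitCantorSet M 𝒜 (k + 1) →
      ∃ c ∈ digitCantorSet M 𝒜 k, ∃ d ∈ digitSet M 𝒜, (M : ℤ) * c + d = x := by
  induction k with
  | zero =>
    intro x hx
    obtain ⟨a, ha, c, hc, rfl⟩ := mem_cantorSet_succ.1 hx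
    simp only [digitCantorSet, Finset.mem_singleton] at hc
    exact ⟨0, by simp [digitCantorSet], a, Finset.mem_image_of_mem _ ha, by simp [hc]⟩
  | succ k ih =>
    intro x hx
    obtain ⟨a, ha, c, hc, rfl⟩ := mem_cantorSet_succ.1 hx
    obtain ⟨c', hc', d, hd, rfl⟩ := ih hc
    exact ⟨_, mem_cantorSet_succ.2 ⟨a, ha, c', hc', rfl⟩, d, hd, by ring⟩

/-- The Cooley–Tukey splitting: in `(M c + d)(a n + b) / (M n)` the cross term `c a` is an integer
and drops out. The remaining twist in `d b` is unimodular. -/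
theorem fourierKernel_split {M n : ℕ} (hM : M ≠ 0) (hn : n ≠ 0) (a b c d : ℤ) :
    fourierKernel (M * n) (M * c + d) (a * n + b) =
      fourierKernel n c b * (Complex.exp (-(2 * Real.pi * Complex.I * d * b) / ((M * n : ℕ) : ℂ)) *
        fourierKernel M d a) := by
  have hM' : (M : ℂ) ≠ 0 := by exact_mod_cast hM
  have hn' : (n : ℂ) ≠ 0 := by exact_mod_cast hn
  have key : Complex.exp (-(2 * Real.pi * Complex.I * ((M * c + d : ℤ) : ℂ) * ((a * n + b : ℤ) : ℂ))
        / ((M * n : ℕ) : ℂ)) =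
      Complex.exp (-(2 * Real.pi * Complex.I * c * b) / (n : ℂ)) *
        (Complex.exp (-(2 * Real.pi * Complex.I * d * b) / ((M * n : ℕ) : ℂ)) *
          Complex.exp (-(2 * Real.pi * Complex.I * d * a) / (M : ℂ))) := by
    rw [← Complex.exp_add, ← Complex.exp_add, Complex.exp_eq_exp_iff_exists_int]
    refine ⟨-(c * a), ?_⟩
    push_cast
    field_simp
    ring
  unfold fourierKernel
  rw [key]
  push_cast
  rw [Real.sqrt_mul (by positivity)]
  push_cast
  ring

theorem sum_cantorSet_succ {M : ℕ} {𝒜 : Finset (Fin M)} {k : ℕ} {E : Type*} [AddCommMonoid E]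
    (f : ℤ → E) :
    ∑ l ∈ digitCantorSet M 𝒜 (k + 1), f l =
      ∑ b ∈ digitCantorSet M 𝒜 k, ∑ a ∈ digitSet M 𝒜, f (a * (M : ℤ) ^ k + b) := by
  rw [digitCantorSet, Finset.sum_image, Finset.sum_product_right]
  · refine Finset.sum_congr rfl fun b _ => ?_
    rw [digitSet, Finset.sum_image]
    intro x _ y _ h
    exact Fin.ext (by simpa using h)
  · rintro ⟨a, c⟩ h ⟨a', c'⟩ h' heq
    simp only [Finset.coe_product, Set.mem_prod, Finset.mem_coe] at h h'
    simp only at heq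
    obtain ⟨h0, h1⟩ := cantorSet_bounds h.2
    obtain ⟨h0', h1'⟩ := cantorSet_bounds h'.2
    have hp : (0 : ℤ) < (M : ℤ) ^ k := h0.trans_lt h1
    have hc : c = c' := by
      have e1 := congrArg (· % (M : ℤ) ^ k) heq
      simp only [Int.mul_add_emod_self_right] at e1
      rwa [Int.emod_eq_of_lt h0 h1, Int.emod_eq_of_lt h0' h1'] at e1
    subst hc
    have : (a : ℤ) = a' := by
      have : (a : ℤ) * (M : ℤ) ^ k = a' * (M : ℤ) ^ k := by linarith
      exact mul_right_cancel₀ hp.ne' this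
    exact Prod.ext (Fin.ext (by exact_mod_cast this)) rfl

theorem norm_exp_phase (x y : ℤ) (N : ℕ) :
    ‖Complex.exp (-(2 * Real.pi * Complex.I * x * y) / (N : ℂ))‖ = 1 := by
  have : -(2 * Real.pi * Complex.I * x * y) / (N : ℂ) =
      ((-(2 * Real.pi * x * y) / N : ℝ) : ℂ) * Complex.I := by push_cast; ring
  rw [this, Complex.norm_exp_ofReal_mul_I]

/-- Induction on scales: for each last digit `d` the sum over `a` is a transform in dimension `M`,
followed by one in dimension `M ^ k`. The twist between them does not affect norms, so the constants
multiply. -/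
theorem FourierBound.pow {M : ℕ} (hM : M ≠ 0) {𝒜 : Finset (Fin M)} {r : ℝ}
    (h : FourierBound M (digitSet M 𝒜) (digitSet M 𝒜) r) (k : ℕ) :
    FourierBound (M ^ k) (digitCantorSet M 𝒜 k) (digitCantorSet M 𝒜 k) (r ^ k) := by
  induction k with
  | zero => intro u; simp [digitCantorSet, fourierKernel]
  | succ k ih =>
    intro u
    have hn : M ^ k ≠ 0 := pow_ne_zero _ hM
    set w : ℤ → ℤ → ℂ := fun d b =>
      ∑ a ∈ digitSet M 𝒜, fourierKernel M d a * u (a * (M : ℤ) ^ k + b) with hw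
    have key (c d : ℤ) : ∑ l ∈ digitCantorSet M 𝒜 (k + 1),
        fourierKernel (M ^ (k + 1)) (M * c + d) l * u l =
        ∑ b ∈ digitCantorSet M 𝒜 k, fourierKernel (M ^ k) c b *
          (Complex.exp (-(2 * Real.pi * Complex.I * d * b) / ((M * M ^ k : ℕ) : ℂ)) * w d b) := by
      rw [sum_cantorSet_succ]
      refine Finset.sum_congr rfl fun b _ => ?_
      rw [hw, Finset.mul_sum, Finset.mul_sum]
      refine Finset.sum_congr rfl fun a _ => ?_
      have := fourierKernel_split hM hn a b c d
      rw [pow_succ', show (a * (M : ℤ) ^ k + b) = a * ((M ^ k : ℕ) : ℤ) + b by push_cast; ring, this]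
      ring
    set g : ℤ → ℝ := fun j => ‖∑ l ∈ digitCantorSet M 𝒜 (k + 1),
        fourierKernel (M ^ (k + 1)) j l * u l‖ ^ 2 with hg
    -- The summands are nonnegative, so covering by pairs (last digit, rest) suffices.
    have hsub : ∑ j ∈ digitCantorSet M 𝒜 (k + 1), g j ≤
        ∑ d ∈ digitSet M 𝒜, ∑ c ∈ digitCantorSet M 𝒜 k, g (M * c + d) := by
      rw [← Finset.sum_product']
      have himg : digitCantorSet M 𝒜 (k + 1) ⊆
          (digitSet M 𝒜 ×ˢ digitCantorSet M 𝒜 k).image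
            (fun p : ℤ × ℤ => (M : ℤ) * p.2 + p.1) := by
        intro x hx
        obtain ⟨c, hc, d, hd, rfl⟩ := exists_last_digit hx
        exact Finset.mem_image.2 ⟨(d, c), Finset.mem_product.2 ⟨hd, hc⟩, rfl⟩
      refine (Finset.sum_le_sum_of_subset_of_nonneg himg fun _ _ _ => by positivity).trans ?_
      exact Finset.sum_image_le_of_nonneg (fun _ _ => by positivity)
    refine hsub.trans ?_
    calc ∑ d ∈ digitSet M 𝒜, ∑ c ∈ digitCantorSet M 𝒜 k, g (M * c + d)
        ≤ ∑ d ∈ digitSet M 𝒜, (r ^ k) ^ 2 * ∑ b ∈ digitCantorSet M 𝒜 k, ‖w d b‖ ^ 2 := by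
          refine Finset.sum_le_sum fun d _ => ?_
          have := ih (fun b => Complex.exp (-(2 * Real.pi * Complex.I * d * b) /
            ((M * M ^ k : ℕ) : ℂ)) * w d b)
          simp only [norm_mul, norm_exp_phase, one_mul] at this
          simpa only [hg, key] using this
      _ = (r ^ k) ^ 2 * ∑ b ∈ digitCantorSet M 𝒜 k, ∑ d ∈ digitSet M 𝒜, ‖w d b‖ ^ 2 := by
          rw [← Finset.mul_sum, Finset.sum_comm]
      _ ≤ (r ^ k) ^ 2 * ∑ b ∈ digitCantorSet M 𝒜 k,
            r ^ 2 * ∑ a ∈ digitSet M 𝒜, ‖u (a * (M : ℤ) ^ k + b)‖ ^ 2 := by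
          gcongr with b _
          exact h fun a => u (a * (M : ℤ) ^ k + b)
      _ = (r ^ (k + 1)) ^ 2 * ∑ l ∈ digitCantorSet M 𝒜 (k + 1), ‖u l‖ ^ 2 := by
          rw [sum_cantorSet_succ, ← Finset.mul_sum]; ring

/-! ### Stability of the Fourier bound under translation and covering -/

/-- Translating either set only multiplies the kernel by unimodular factors, one depending on `j`
and one on `l`. -/
theorem FourierBound.translate {N : ℕ} {X Y : Finset ℤ} {r : ℝ} (h : FourierBound N X Y r)
    (s t : ℤ) : FourierBound N (X.image (· + s)) (Y.image (· + t)) r := by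
  intro u
  simp only [Finset.sum_image fun x _ y _ (h : x + s = y + s) => by simpa using h,
    Finset.sum_image fun x _ y _ (h : x + t = y + t) => by simpa using h]
  have hk (j l : ℤ) : fourierKernel N (j + s) (l + t) =
      Complex.exp (-(2 * Real.pi * Complex.I * (j + s : ℤ) * t) / (N : ℂ)) *
        (fourierKernel N j l *
          Complex.exp (-(2 * Real.pi * Complex.I * s * l) / (N : ℂ))) := by
    have : Complex.exp (-(2 * Real.pi * Complex.I * ((j + s : ℤ) : ℂ) * ((l + t : ℤ) : ℂ)) / (N : ℂ))
        = Complex.exp (-(2 * Real.pi * Complex.I * (j + s : ℤ) * t) / (N : ℂ)) *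
        (Complex.exp (-(2 * Real.pi * Complex.I * j * l) / (N : ℂ)) *
          Complex.exp (-(2 * Real.pi * Complex.I * s * l) / (N : ℂ))) := by
      rw [← Complex.exp_add, ← Complex.exp_add]
      congr 1
      push_cast
      ring
    unfold fourierKernel
    rw [this]; ring
  have := h fun l => Complex.exp (-(2 * Real.pi * Complex.I * s * l) / (N : ℂ)) * u (l + t)
  simp only [norm_mul, norm_exp_phase, one_mul] at this
  refine le_trans (le_of_eq ?_) this
  refine Finset.sum_congr rfl fun j _ => ?_
  simp only [hk]
  rw [Finset.sum_congr rfl fun l _ => (by ring : _ = Complex.exp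
    (-(2 * Real.pi * Complex.I * (j + s : ℤ) * t) / (N : ℂ)) * (fourierKernel N j l *
      (Complex.exp (-(2 * Real.pi * Complex.I * s * l) / (N : ℂ)) * u (l + t)))),
    ← Finset.mul_sum, norm_mul, norm_exp_phase, one_mul]

theorem FourierBound.mono {N : ℕ} {X Y X' Y' : Finset ℤ} {r : ℝ} (h : FourierBound N X Y r)
    (hX : X' ⊆ X) (hY : Y' ⊆ Y) : FourierBound N X' Y' r := by
  intro u
  have := h fun l => if l ∈ Y' then u l else 0
  have e1 (j : ℤ) : ∑ l ∈ Y, fourierKernel N j l * (if l ∈ Y' then u l else 0) =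
      ∑ l ∈ Y', fourierKernel N j l * u l := by
    rw [← Finset.sum_subset hY (by intro x _ hx; simp [hx])]
    exact Finset.sum_congr rfl fun l hl => by simp [hl]
  have e2 : ∑ l ∈ Y, ‖if l ∈ Y' then u l else 0‖ ^ 2 = ∑ l ∈ Y', ‖u l‖ ^ 2 := by
    rw [← Finset.sum_subset hY (by intro x _ hx; simp [hx])]
    exact Finset.sum_congr rfl fun l hl => by simp [hl]
  simp only [e1, e2] at this
  exact (Finset.sum_le_sum_of_subset_of_nonneg hX fun _ _ _ => by positivity).trans this

/-- A set covered by translates of `X` inherits the bound, with a loss of the number of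
translates. -/
theorem FourierBound.of_covering {N : ℕ} {X Z S : Finset ℤ} {r : ℝ} (h : FourierBound N X X r)
    (hZ : ∀ z ∈ Z, ∃ s ∈ S, z - s ∈ X) : FourierBound N Z Z (S.card * r) := by
  intro u
  choose! σ hσS hσX using hZ
  set Zs : ℤ → Finset ℤ := fun s => Z.filter fun z => σ z = s with hZs
  have hb (s t : ℤ) : FourierBound N (Zs s) (Zs t) r := by
    refine (h.translate s t).mono ?_ ?_ <;>
    · intro z hz
      simp only [hZs, Finset.mem_filter] at hz
      refine Finset.mem_image.2 ⟨z - σ z, hσX z hz.1, ?_⟩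
      rw [hz.2]; ring
  have hsplit {E : Type} [AddCommMonoid E] (f : ℤ → E) :
      ∑ s ∈ S, ∑ z ∈ Zs s, f z = ∑ z ∈ Z, f z :=
    Finset.sum_fiberwise_of_maps_to (fun z hz => hσS z hz) f
  calc ∑ j ∈ Z, ‖∑ l ∈ Z, fourierKernel N j l * u l‖ ^ 2
      -- Cauchy–Schwarz over the column pieces gives one factor `S.card`; summing over the row
      -- pieces gives the other.
      ≤ ∑ j ∈ Z, S.card * ∑ t ∈ S, ‖∑ l ∈ Zs t, fourierKernel N j l * u l‖ ^ 2 := by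
        refine Finset.sum_le_sum fun j _ => ?_
        rw [← hsplit fun l => fourierKernel N j l * u l]
        refine (pow_le_pow_left₀ (norm_nonneg _) (norm_sum_le _ _) 2).trans ?_
        exact sq_sum_le_card_mul_sum_sq
    _ = S.card * ∑ s ∈ S, ∑ t ∈ S, ∑ j ∈ Zs s, ‖∑ l ∈ Zs t, fourierKernel N j l * u l‖ ^ 2 := by
        rw [← Finset.mul_sum,
          ← hsplit fun j => ∑ t ∈ S, ‖∑ l ∈ Zs t, fourierKernel N j l * u l‖ ^ 2]
        congr 1
        exact Finset.sum_congr rfl fun s _ => Finset.sum_comm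
    _ ≤ S.card * ∑ s ∈ S, ∑ t ∈ S, r ^ 2 * ∑ l ∈ Zs t, ‖u l‖ ^ 2 := by
        gcongr with s _ t _
        exact hb s t u
    _ = (S.card * r) ^ 2 * ∑ l ∈ Z, ‖u l‖ ^ 2 := by
        simp only [← Finset.mul_sum]
        rw [hsplit fun l => ‖u l‖ ^ 2, Finset.sum_const, nsmul_eq_mul]
        ring

/-! ### From decay of Fourier coefficients to an operator bound -/

theorem fourierKernel_comm (N : ℕ) (j l : ℤ) : fourierKernel N j l = fourierKernel N l j := by
  unfold fourierKernel
  rw [mul_right_comm]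

theorem fourierKernel_mul_conj (N : ℕ) (j j' l : ℤ) :
    fourierKernel N j l * (starRingEnd ℂ) (fourierKernel N j' l) =
      (1 / (N : ℂ)) * Complex.exp (-(2 * Real.pi * Complex.I * l * (j - j' : ℤ)) / (N : ℂ)) := by
  unfold fourierKernel
  rw [map_mul, ← Complex.exp_conj]
  have e1 : (1 / (Real.sqrt N : ℂ)) * (starRingEnd ℂ) (1 / (Real.sqrt N : ℂ)) = 1 / (N : ℂ) := by
    rw [map_div₀, Complex.conj_ofReal, map_one, div_mul_div_comm, one_mul, ← Complex.ofReal_mul,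
      Real.mul_self_sqrt (by positivity)]
    simp
  rw [mul_mul_mul_comm, e1, ← Complex.exp_add]
  congr 2
  simp only [map_div₀, map_neg, map_mul, map_ofNat, Complex.conj_ofReal, Complex.conj_I,
    map_intCast, map_natCast]
  push_cast
  ring

/-- Off-diagonal decay of the Fourier transform of the indicator function of `X` bounds the
operator norm, by the `T T*` argument. -/
theorem FourierBound.of_decay {N : ℕ} {X : Finset ℤ} {t : ℝ}
    (ht : 0 ≤ t) (hX : ∀ l ∈ X, ∀ l' ∈ X, l ≠ l' →
      ‖∑ j ∈ X, Complex.exp (-(2 * Real.pi * Complex.I * j * (l - l' : ℤ)) / (N : ℂ))‖ ≤ t) :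
    FourierBound N X X (Real.sqrt ((X.card + t * X.card) / N)) := by
  intro u
  rw [Real.sq_sqrt (by positivity)]
  set H : ℤ → ℤ → ℂ := fun l l' =>
    ∑ j ∈ X, Complex.exp (-(2 * Real.pi * Complex.I * j * (l - l' : ℤ)) / (N : ℂ)) with hH
  -- The spare `t` on the diagonal completes the off-diagonal sum to the full square `(∑ ‖u l‖) ^
  -- 2`.
  have hHb : ∀ l ∈ X, ∀ l' ∈ X, ‖H l l'‖ ≤ (if l = l' then (X.card : ℝ) else 0) + t := by
    intro l hl l' hl'
    split_ifs with h
    · subst h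
      simp [hH, ht]
    · simpa only [zero_add] using hX l hl l' hl' h
  have hkk (j l l' : ℤ) : fourierKernel N j l * (starRingEnd ℂ) (fourierKernel N j l') =
      (1 / (N : ℂ)) *
        Complex.exp (-(2 * Real.pi * Complex.I * j * (l - l' : ℤ)) / (N : ℂ)) := by
    rw [fourierKernel_comm N j l, fourierKernel_comm N j l', fourierKernel_mul_conj]
  have hexp (j : ℤ) : ((‖∑ l ∈ X, fourierKernel N j l * u l‖ ^ 2 : ℝ) : ℂ) =
      ∑ l ∈ X, ∑ l' ∈ X, (u l * (starRingEnd ℂ) (u l')) * ((1 / (N : ℂ)) *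
        Complex.exp (-(2 * Real.pi * Complex.I * j * (l - l' : ℤ)) / (N : ℂ))) := by
    rw [Complex.ofReal_pow, ← Complex.mul_conj', map_sum, Finset.sum_mul_sum]
    refine Finset.sum_congr rfl fun l _ => Finset.sum_congr rfl fun l' _ => ?_
    rw [← hkk, map_mul]
    ring
  have htot : ((∑ j ∈ X, ‖∑ l ∈ X, fourierKernel N j l * u l‖ ^ 2 : ℝ) : ℂ) =
      ∑ l ∈ X, ∑ l' ∈ X, (u l * (starRingEnd ℂ) (u l')) * ((1 / (N : ℂ)) * H l l') := by
    rw [Complex.ofReal_sum]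
    simp only [hexp]
    rw [Finset.sum_comm]
    refine Finset.sum_congr rfl fun l _ => ?_
    rw [Finset.sum_comm]
    refine Finset.sum_congr rfl fun l' _ => ?_
    rw [hH, Finset.mul_sum, Finset.mul_sum]
  have hnn : 0 ≤ ∑ j ∈ X, ‖∑ l ∈ X, fourierKernel N j l * u l‖ ^ 2 := by positivity
  rw [← abs_of_nonneg hnn, ← Real.norm_eq_abs, ← Complex.norm_real, htot]
  calc ‖∑ l ∈ X, ∑ l' ∈ X, (u l * (starRingEnd ℂ) (u l')) * ((1 / (N : ℂ)) * H l l')‖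
      ≤ ∑ l ∈ X, ∑ l' ∈ X, (‖u l‖ * ‖u l'‖) * ((1 / (N : ℝ)) *
          ((if l = l' then (X.card : ℝ) else 0) + t)) := by
        refine (norm_sum_le _ _).trans (Finset.sum_le_sum fun l hl => ?_)
        refine (norm_sum_le _ _).trans (Finset.sum_le_sum fun l' hl' => ?_)
        rw [norm_mul, norm_mul, norm_mul, RCLike.norm_conj]
        have : ‖(1 / (N : ℂ))‖ = 1 / (N : ℝ) := by simp
        rw [this]
        gcongr
        exact hHb l hl l' hl'
    _ = (1 / N) * (X.card * ∑ l ∈ X, ‖u l‖ ^ 2 + t * (∑ l ∈ X, ‖u l‖) ^ 2) := by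
        rw [sq (∑ l ∈ X, ‖u l‖), Finset.sum_mul_sum, Finset.mul_sum, Finset.mul_sum,
          ← Finset.sum_add_distrib, Finset.mul_sum]
        refine Finset.sum_congr rfl fun l hl => ?_
        have : ∀ l' ∈ X, (‖u l‖ * ‖u l'‖) * ((1 / (N : ℝ)) *
            ((if l = l' then (X.card : ℝ) else 0) + t)) =
            (if l = l' then (‖u l‖ * ‖u l'‖) * ((1 / (N : ℝ)) * X.card) else 0) +
              (1 / N) * t * (‖u l‖ * ‖u l'‖) := by
          intro l' _; split_ifs <;> ring
        rw [Finset.sum_congr rfl this, Finset.sum_add_distrib, Finset.sum_ite_eq, if_pos hl,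
          ← Finset.mul_sum]
        ring
    _ ≤ (1 / N) * (X.card * ∑ l ∈ X, ‖u l‖ ^ 2 + t * (X.card * ∑ l ∈ X, ‖u l‖ ^ 2)) := by
        gcongr
        exact sq_sum_le_card_mul_sum_sq
    _ = (X.card + t * X.card) / N * ∑ l ∈ X, ‖u l‖ ^ 2 := by ring

/-! ### Nonstationary phase for discrete sums -/

theorem ContDiff.exists_fwdDiff_iter_le (K : ℕ) : ∀ f : ℝ → ℝ, ContDiff ℝ ∞ f →
    HasCompactSupport f →
    ∃ C : ℝ, 0 ≤ C ∧ ∀ h : ℝ, 0 ≤ h → ∀ x, |(fwdDiff h)^[K] f x| ≤ C * h ^ K := by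
  -- Differences commute with differentiation, so each order follows from the previous one for
  -- `deriv f` by the mean value inequality.
  have hderiv : ∀ (h : ℝ) (K : ℕ) (f : ℝ → ℝ), ContDiff ℝ ∞ f → ∀ x,
      HasDerivAt ((fwdDiff h)^[K] f) ((fwdDiff h)^[K] (deriv f) x) x := by
    intro h K
    induction K with
    | zero =>
      intro f hf x
      exact (hf.differentiable (by simp) x).hasDerivAt
    | succ K ih =>
      intro f hf x
      rw [Function.iterate_succ_apply', Function.iterate_succ_apply']
      exact ((ih f hf (x + h)).comp_add_const x h).sub (ih f hf x)
  induction K with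
  | zero =>
    intro f hf hc
    obtain ⟨C, hC⟩ := hc.exists_bound_of_continuous hf.continuous
    exact ⟨C, (norm_nonneg _).trans (hC 0), fun h _ x => by simpa using hC x⟩
  | succ K ih =>
    intro f hf hc
    obtain ⟨C, hC0, hC⟩ := ih (deriv f) ((contDiff_infty_iff_deriv.1 hf).2) hc.deriv
    refine ⟨C, hC0, fun h hh x => ?_⟩
    rw [Function.iterate_succ_apply']
    have := convex_univ.norm_image_sub_le_of_norm_hasDerivWithin_le
      (f := (fwdDiff h)^[K] f) (C := C * h ^ K)
      (fun y _ => (hderiv h K f hf y).hasDerivWithinAt)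
      (fun y _ => hC h hh y) (Set.mem_univ x) (Set.mem_univ (x + h))
    simpa [fwdDiff, abs_of_nonneg hh, pow_succ, mul_assoc] using this

/-- Summation by parts over all integers: finite support removes boundary terms, and shifting the
index produces `z⁻¹`. -/
theorem finsum_fwdDiff_mul_zpow {G : ℤ → ℂ} (hG : (Function.support G).Finite) {z : ℂ}
    (hz : z ≠ 0) :
    ∑ᶠ m : ℤ, (G (m + 1) - G m) * z ^ m = (z⁻¹ - 1) * ∑ᶠ m : ℤ, G m * z ^ m := by
  have hfin : (Function.support fun m : ℤ => G m * z ^ m).Finite :=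
    hG.subset (Function.support_mul_subset_left _ _)
  have hshift : ∑ᶠ m : ℤ, G (m + 1) * z ^ (m + 1) = ∑ᶠ m : ℤ, G m * z ^ m :=
    finsum_comp_equiv (Equiv.addRight (1 : ℤ)) (f := fun m : ℤ => G m * z ^ m)
  have hfin' : (Function.support fun m : ℤ => G (m + 1) * z ^ (m + 1)).Finite := by
    refine (hfin.preimage (f := fun m : ℤ => m + 1) (add_left_injective 1).injOn).subset ?_
    intro m hm
    exact hm
  have e : ∀ m : ℤ, (G (m + 1) - G m) * z ^ m =
      z⁻¹ * (G (m + 1) * z ^ (m + 1)) - G m * z ^ m := by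
    intro m
    rw [zpow_add_one₀ hz]
    field_simp
  rw [finsum_congr e, finsum_sub_distrib _ hfin,
    ← mul_finsum (fun m : ℤ => G (m + 1) * z ^ (m + 1)), hshift]
  · ring
  · exact hfin'.subset (Function.support_mul_subset_right _ _)

/-- The margin keeps the phase difference `y - x` away from `±1`, where the exponentials would
resonate again. -/
theorem IsCutoff.exists_margin {χ : ℝ → ℝ} (hχ : IsCutoff χ) :
    ∃ c : ℝ, 0 < c ∧ ∀ x, χ x ≠ 0 → c ≤ x ∧ x ≤ 1 - c := by
  have hK : IsCompact (tsupport χ) :=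
    isCompact_Icc.of_isClosed_subset (isClosed_tsupport χ)
      (hχ.tsupport_subset.trans Set.Ioo_subset_Icc_self)
  obtain ⟨c, hc, h⟩ := hK.exists_forall_le' (f := fun x : ℝ => min x (1 - x)) (a := 0)
    (by fun_prop) (fun b hb => by
      have := hχ.tsupport_subset hb
      exact lt_min this.1 (by linarith [this.2]))
  refine ⟨c, hc, fun x hx => ?_⟩
  have := le_min_iff.1 (h x (subset_tsupport χ hx))
  exact ⟨this.1, by linarith [this.2]⟩

theorem IsCutoff.hasCompactSupport {χ : ℝ → ℝ} (hχ : IsCutoff χ) : HasCompactSupport χ :=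
  isCompact_Icc.of_isClosed_subset (isClosed_tsupport χ)
    (hχ.tsupport_subset.trans Set.Ioo_subset_Icc_self)

/-- The norm is `2 |sin (π θ)|`, at least four times the smaller of `|θ|` and `1 - |θ|` by concavity
of the sine. Both are at least `c |θ|`. -/
theorem four_mul_min_le_norm_exp_sub_one {θ c : ℝ} (hθ : |θ| ≤ 1 - c) (hc : c ≤ 1) (hc0 : 0 ≤ c) :
    4 * c * |θ| ≤ ‖Complex.exp (Complex.I * (2 * Real.pi * θ : ℝ)) - 1‖ := by
  rw [Complex.norm_exp_I_mul_ofReal_sub_one, norm_mul, Real.norm_eq_abs, Real.norm_eq_abs,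
    abs_of_nonneg (zero_le_two (α := ℝ))]
  have e : 2 * Real.pi * θ / 2 = Real.pi * θ := by ring
  have hπ := Real.pi_pos
  have h0 := abs_nonneg θ
  rw [e, Real.abs_sin_eq_sin_abs_of_abs_le_pi (by
    rw [abs_mul, abs_of_pos hπ]; nlinarith)]
  rw [abs_mul, abs_of_pos hπ]
  rcases le_total |θ| (1 / 2) with h | h
  · have := Real.mul_le_sin (x := Real.pi * |θ|) (by positivity) (by nlinarith)
    have e2 : 2 / Real.pi * (Real.pi * |θ|) = 2 * |θ| := by field_simp
    rw [e2] at this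
    nlinarith
  · have := Real.mul_le_sin (x := Real.pi * (1 - |θ|)) (by
      apply mul_nonneg hπ.le; linarith) (by nlinarith)
    have e2 : 2 / Real.pi * (Real.pi * (1 - |θ|)) = 2 * (1 - |θ|) := by field_simp
    rw [e2, show Real.pi * (1 - |θ|) = Real.pi - Real.pi * |θ| by ring, Real.sin_pi_sub] at this
    nlinarith

/-- Nonstationary phase for exponential sums with a smooth weight. -/
theorem IsCutoff.exists_sum_bound {χ : ℝ → ℝ} (hχ : IsCutoff χ) (K : ℕ) :
    ∃ C : ℝ, 0 < C ∧ ∀ n : ℕ, 0 < n → ∀ W : ℝ, 0 < W → ∀ x y : ℝ, χ x ≠ 0 → 0 ≤ y → y ≤ 1 →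
      W / n ≤ |y - x| →
      ‖∑ m ∈ Finset.range n, (χ (m / n) : ℂ) * Complex.exp (2 * Real.pi * Complex.I * m * (y - x))‖
        ≤ C * n / W ^ K := by
  obtain ⟨C, hC0, hC⟩ := ContDiff.exists_fwdDiff_iter_le K χ hχ.smooth hχ.hasCompactSupport
  obtain ⟨c, hc, hcx⟩ := hχ.exists_margin
  -- After `K` summations by parts at most `n + K + 1 ≤ (K + 2) n` terms remain, each of size `C / n
  -- ^ K`, against `(4 c W / n) ^ K`. Using `C + 1` makes the constant positive.
  refine ⟨(K + 2) * (C + 1) / (4 * c) ^ K, by positivity, ?_⟩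
  intro n hn W hW x y hx hy0 hy1 hxy
  have hn' : (0 : ℝ) < n := by exact_mod_cast hn
  set θ := y - x with hθ
  set z : ℂ := Complex.exp (Complex.I * (2 * Real.pi * θ : ℝ)) with hz
  have hz1 : ‖z‖ = 1 := by rw [hz, mul_comm, Complex.norm_exp_ofReal_mul_I]
  have hz0 : z ≠ 0 := Complex.exp_ne_zero _
  obtain ⟨hcx0, hcx1⟩ := hcx x hx
  have hθc : |θ| ≤ 1 - c := by rw [abs_le]; constructor <;> linarith
  have hlow : 4 * c * (W / n) ≤ ‖z - 1‖ :=
    (mul_le_mul_of_nonneg_left hxy (by positivity)).trans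
      (four_mul_min_le_norm_exp_sub_one hθc (by linarith [abs_nonneg θ]) hc.le)
  have hinv : ‖z⁻¹ - 1‖ = ‖z - 1‖ := by
    have : z⁻¹ - 1 = -(z⁻¹ * (z - 1)) := by field_simp; ring
    rw [this, norm_neg, norm_mul, norm_inv, hz1, inv_one, one_mul]
  set D : ℕ → ℤ → ℂ := fun k m => ((((fwdDiff (1 / n : ℝ))^[k] χ) (m / n) : ℝ) : ℂ) with hD
  have hDsucc : ∀ k m, D (k + 1) m = D k (m + 1) - D k m := by
    intro k m
    simp only [hD, Function.iterate_succ_apply', fwdDiff]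
    push_cast
    rw [add_div]
  have hsupp : ∀ k : ℕ, Function.support (D k) ⊆ (Finset.Icc (-k : ℤ) n : Set ℤ) := by
    intro k
    induction k with
    | zero =>
      intro m hm
      have hm' : χ (m / n) ≠ 0 := by simpa [hD] using hm
      obtain ⟨h0, h1⟩ := hcx _ hm'
      have h0' : (0 : ℝ) ≤ m := by
        by_contra! h
        linarith [div_neg_of_neg_of_pos h hn']
      have h1' : (m : ℝ) ≤ n := (div_le_one hn').1 (by linarith)
      simp only [Nat.cast_zero, neg_zero, Finset.coe_Icc, Set.mem_Icc]
      exact ⟨by exact_mod_cast h0', by exact_mod_cast h1'⟩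
    | succ k ih =>
      intro m hm
      have : D k (m + 1) ≠ 0 ∨ D k m ≠ 0 := by
        by_contra! h
        exact hm (by rw [hDsucc, h.1, h.2, sub_zero])
      simp only [Finset.coe_Icc, Set.mem_Icc] at ih ⊢
      rcases this with h | h
      · have := ih h
        simp only [Set.mem_Icc] at this
        push_cast; omega
      · have := ih h
        simp only [Set.mem_Icc] at this
        push_cast; omega
  have hfin : ∀ k, (Function.support (D k)).Finite := fun k =>
    (Finset.finite_toSet _).subset (hsupp k)
  have hrec : ∀ k, ∑ᶠ m : ℤ, D k m * z ^ m = (z⁻¹ - 1) ^ k * ∑ᶠ m : ℤ, D 0 m * z ^ m := by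
    intro k
    induction k with
    | zero => simp
    | succ k ih =>
      rw [finsum_congr fun m => by rw [hDsucc], finsum_fwdDiff_mul_zpow (hfin k) hz0, ih]
      ring
  have hS0 : ∑ᶠ m : ℤ, D 0 m * z ^ m = ∑ m ∈ Finset.range n, (χ (m / n) : ℂ) *
      Complex.exp (2 * Real.pi * Complex.I * m * (y - x)) := by
    have hinj : Set.InjOn (fun m : ℕ => (m : ℤ)) (Finset.range n) :=
      fun a _ b _ h => by simpa using h
    rw [finsum_eq_sum_of_support_subset (s := (Finset.range n).image fun m : ℕ => (m : ℤ)),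
      Finset.sum_image hinj]
    · refine Finset.sum_congr rfl fun m _ => ?_
      rw [hz, ← Complex.exp_int_mul]
      simp only [hD, Function.iterate_zero, id_eq]
      push_cast
      congr 2
      rw [hθ]; push_cast; ring
    · intro m hm
      have hm' : χ (m / n) ≠ 0 := by
        have := left_ne_zero_of_mul hm
        simpa [hD] using this
      obtain ⟨h0, h1⟩ := hcx _ hm'
      have h0' : (0 : ℝ) ≤ m := by
        by_contra! h
        linarith [div_neg_of_neg_of_pos h hn']
      have h1' : (m : ℝ) < n := (div_lt_one hn').1 (by linarith)
      have h0'' : 0 ≤ m := by exact_mod_cast h0'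
      have h1'' : m < n := by exact_mod_cast h1'
      simp only [Finset.coe_image, Finset.coe_range, Set.mem_image, Set.mem_Iio]
      exact ⟨m.toNat, by omega, by omega⟩
  have hupper : ‖∑ᶠ m : ℤ, D K m * z ^ m‖ ≤ (n + K + 1) * (C * (1 / n) ^ K) := by
    rw [finsum_eq_sum_of_support_subset (s := Finset.Icc (-K : ℤ) n)
      _ ((Function.support_mul_subset_left _ _).trans (hsupp K))]
    refine (norm_sum_le_of_le (f := fun m : ℤ => D K m * z ^ m) _
      (n := fun _ => C * (1 / n) ^ K) fun m _ => ?_).trans ?_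
    · rw [norm_mul, norm_zpow, hz1, one_zpow, mul_one, hD, Complex.norm_real]
      exact hC (1 / n) (by positivity) _
    · rw [Finset.sum_const, nsmul_eq_mul, Int.card_Icc]
      have : (((n : ℤ) + 1 - -K).toNat : ℝ) = n + K + 1 := by
        have : ((n : ℤ) + 1 - -K).toNat = n + K + 1 := by omega
        rw [this]; push_cast; ring
      rw [this]
  rw [hrec, norm_mul, norm_pow, hinv, hS0] at hupper
  set S := ‖∑ m ∈ Finset.range n, (χ (m / n) : ℂ) *
      Complex.exp (2 * Real.pi * Complex.I * m * (y - x))‖ with hS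
  have h1 : (4 * c * (W / n)) ^ K * S ≤ (n + K + 1) * (C * (1 / n) ^ K) :=
    (mul_le_mul_of_nonneg_right (pow_le_pow_left₀ (by positivity) hlow K) (norm_nonneg _)).trans
      hupper
  have h2 : (4 * c) ^ K * W ^ K * S ≤ (n + K + 1) * C := by
    have e1 : (4 * c * (W / n)) ^ K * S = ((4 * c) ^ K * W ^ K * S) * (1 / n) ^ K := by
      rw [mul_pow, div_pow, div_pow]; ring
    rw [e1, ← mul_assoc] at h1
    exact le_of_mul_le_mul_right h1 (by positivity)
  have h3 : ((n : ℝ) + K + 1) * C ≤ (K + 2) * (C + 1) * n := by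
    have hn1 : (1 : ℝ) ≤ n := by exact_mod_cast hn
    have hK0 : (0 : ℝ) ≤ K := by positivity
    have : (n : ℝ) + K + 1 ≤ (K + 2) * n := by nlinarith
    calc ((n : ℝ) + K + 1) * C ≤ (K + 2) * n * (C + 1) := by gcongr; linarith
      _ = _ := by ring
  rw [div_mul_eq_mul_div, div_div, le_div_iff₀ (by positivity)]
  linarith

/-! ### The Fourier matrix and the entries of the open quantum map -/

theorem sum_exp_eq_zero {N : ℕ} (hN : N ≠ 0) {d : ℤ} (hd : ¬ (N : ℤ) ∣ d) :
    ∑ l : Fin N, Complex.exp (-(2 * Real.pi * Complex.I * (l : ℕ) * d) / (N : ℂ)) = 0 := by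
  have hN' : (N : ℂ) ≠ 0 := by exact_mod_cast hN
  set z : ℂ := Complex.exp (-(2 * Real.pi * Complex.I * d) / (N : ℂ)) with hz
  have hz1 : z ≠ 1 := by
    intro h
    obtain ⟨m, hm⟩ := Complex.exp_eq_one_iff.1 h
    apply hd
    refine ⟨-m, ?_⟩
    have : (d : ℂ) = N * (-m) := by
      have h2 := Complex.two_pi_I_ne_zero
      rw [div_eq_iff hN'] at hm
      apply mul_left_cancel₀ h2
      linear_combination -hm
    exact_mod_cast this
  have hzN : z ^ N = 1 := by
    rw [hz, ← Complex.exp_nat_mul, Complex.exp_eq_one_iff]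
    refine ⟨-d, ?_⟩
    push_cast
    field_simp
  have hgeom := mul_geom_sum z N
  rw [hzN, sub_self] at hgeom
  have h0 := (mul_eq_zero.1 hgeom).resolve_left (sub_ne_zero.2 hz1)
  rw [Finset.sum_range] at h0
  rw [← h0]
  refine Finset.sum_congr rfl fun l _ => ?_
  rw [hz, ← Complex.exp_nat_mul]
  congr 1
  ring

theorem dftMatrix_apply {N : ℕ} (j l : Fin N) :
    dftMatrix N j l = fourierKernel N (j : ℕ) (l : ℕ) := by
  simp [dftMatrix, fourierKernel]

theorem dftMatrix_transpose (N : ℕ) : (dftMatrix N).transpose = dftMatrix N := by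
  ext j l
  simp only [Matrix.transpose_apply, dftMatrix, Matrix.of_apply]
  congr 3
  ring

theorem dftMatrix_mul_conjTranspose {N : ℕ} (hN : N ≠ 0) :
    dftMatrix N * (dftMatrix N).conjTranspose = 1 := by
  have hN' : (N : ℂ) ≠ 0 := by exact_mod_cast hN
  ext j j'
  rw [Matrix.mul_apply]
  simp only [Matrix.conjTranspose_apply, dftMatrix_apply, RCLike.star_def, fourierKernel_mul_conj]
  rw [← Finset.mul_sum]
  by_cases h : j = j'
  · subst h
    simp [hN']
  · rw [Matrix.one_apply_ne h]
    have hd : ¬ (N : ℤ) ∣ ((j : ℕ) : ℤ) - ((j' : ℕ) : ℤ) := by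
      intro hd
      have h1 := j.2
      have h2 := j'.2
      have := Int.eq_zero_of_abs_lt_dvd hd (by rw [abs_lt]; constructor <;> omega)
      exact h (Fin.ext (by omega))
    have := sum_exp_eq_zero hN hd
    simp only [Int.cast_natCast] at this ⊢
    rw [this, mul_zero]

theorem dftMatrix_inv {N : ℕ} (hN : N ≠ 0) :
    (dftMatrix N)⁻¹ = (dftMatrix N).conjTranspose :=
  Matrix.inv_eq_right_inv (dftMatrix_mul_conjTranspose hN)

theorem openQuantumMap_apply {M n : ℕ} (hM : M ≠ 0) (hn : n ≠ 0) (𝒜 : Finset (Fin M))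
    (χ : ℝ → ℝ) (j : Fin (M * n)) (l : Fin n) (a : Fin M) :
    openQuantumMap M n 𝒜 χ j (blockIndex M n (l, a)) =
      if a ∈ 𝒜 then ∑ b : Fin n, (starRingEnd ℂ) (dftMatrix (M * n) (blockIndex M n (b, a)) j) *
        ((χ ((b : ℕ) / n) : ℂ) * dftMatrix n b l * (χ ((l : ℕ) / n) : ℂ)) else 0 := by
  rw [openQuantumMap, dftMatrix_inv (mul_ne_zero hM hn), Matrix.mul_apply,
    ← (blockIndex M n).sum_comp, Fintype.sum_prod_type_right]
  rw [Finset.sum_eq_single a]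
  · split_ifs with ha
    · refine Finset.sum_congr rfl fun b _ => ?_
      simp [Matrix.blockDiagonal_apply, ha, cutoffMatrix, Matrix.conjTranspose_apply]
    · refine Finset.sum_eq_zero fun b _ => ?_
      simp [Matrix.blockDiagonal_apply, ha]
  · intro a' _ ha'
    refine Finset.sum_eq_zero fun b _ => ?_
    simp [Matrix.blockDiagonal_apply, ha']
  · simp

theorem blockIndex_val {M n : ℕ} (l : Fin n) (a : Fin M) :
    ((blockIndex M n (l, a) : Fin (M * n)) : ℕ) = l + n * a := by
  simp [blockIndex]

/-- Off the graph of the expanding map `l ↦ M l mod N`, the entries of the open quantum map are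
negligible. -/
theorem IsCutoff.exists_norm_openQuantumMap_le {χ : ℝ → ℝ} (hχ : IsCutoff χ) (K : ℕ) :
    ∃ C : ℝ, 0 < C ∧ ∀ M n : ℕ, 0 < M → 0 < n → ∀ 𝒜 : Finset (Fin M), ∀ W : ℝ, 0 < W →
      ∀ (j : Fin (M * n)) (l : Fin n) (a : Fin M),
        M * W ≤ |((j : ℕ) : ℝ) - M * (l : ℕ)| →
        ‖openQuantumMap M n 𝒜 χ j (blockIndex M n (l, a))‖ ≤ C * n / W ^ K := by
  obtain ⟨C, hC0, hC⟩ := hχ.exists_sum_bound K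
  refine ⟨C, hC0, fun M n hM hn 𝒜 W hW j l a hjl => ?_⟩
  have hM' : (0 : ℝ) < M := by exact_mod_cast hM
  have hn' : (0 : ℝ) < n := by exact_mod_cast hn
  have hMc : (M : ℂ) ≠ 0 := by exact_mod_cast hM.ne'
  have hnc : (n : ℂ) ≠ 0 := by exact_mod_cast hn.ne'
  have hrhs : 0 ≤ C * n / W ^ K := by positivity
  rw [openQuantumMap_apply hM.ne' hn.ne']
  split_ifs with ha
  swap
  · simpa using hrhs
  by_cases hl : χ ((l : ℕ) / n) = 0
  · simpa [hl] using hrhs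
  set x : ℝ := (l : ℕ) / n with hx
  set y : ℝ := (j : ℕ) / ((M * n : ℕ) : ℝ) with hy
  have hjlt : ((j : ℕ) : ℝ) < ((M * n : ℕ) : ℝ) := by exact_mod_cast j.2
  have hMn : (0 : ℝ) < ((M * n : ℕ) : ℝ) := by push_cast; positivity
  have hbound := hC n hn W hW x y hl (by positivity) ((div_le_one hMn).2 hjlt.le) (by
    have : y - x = (((j : ℕ) : ℝ) - M * (l : ℕ)) / (M * n) := by
      rw [hx, hy]; push_cast; field_simp
    rw [this, abs_div, abs_of_pos (show (0 : ℝ) < M * n by positivity), div_le_div_iff₀ hn'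
      (by positivity)]
    nlinarith)
  -- All factors independent of `b` are pulled out and have norm at most one. What is left is the
  -- smooth exponential sum of frequency `y - x = (j - M l) / (M n)`.
  have hterm : ∀ b : Fin n, (starRingEnd ℂ) (dftMatrix (M * n) (blockIndex M n (b, a)) j) *
        ((χ ((b : ℕ) / n) : ℂ) * dftMatrix n b l * (χ ((l : ℕ) / n) : ℂ)) =
      ((1 / (Real.sqrt (M * n : ℕ) : ℂ)) * (1 / (Real.sqrt n : ℂ)) * (χ ((l : ℕ) / n) : ℂ) *
        Complex.exp (-(2 * Real.pi * Complex.I * (-(j : ℕ) : ℤ) * (a : ℕ)) / (M : ℂ))) *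
      ((χ ((b : ℕ) / n) : ℂ) *
        Complex.exp (2 * Real.pi * Complex.I * (b : ℕ) * (y - x))) := by
    intro b
    have hexp : Complex.exp ((starRingEnd ℂ) (-(2 * Real.pi * Complex.I *
          ((blockIndex M n (b, a) : Fin (M * n)) : ℕ) * (j : ℕ)) / ((M * n : ℕ) : ℂ))) *
        Complex.exp (-(2 * Real.pi * Complex.I * (b : ℕ) * (l : ℕ)) / (n : ℂ)) =
        Complex.exp (-(2 * Real.pi * Complex.I * (-(j : ℕ) : ℤ) * (a : ℕ)) / (M : ℂ)) *
        Complex.exp (2 * Real.pi * Complex.I * (b : ℕ) * (y - x)) := by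
      rw [← Complex.exp_add, ← Complex.exp_add, blockIndex_val, hx, hy]
      congr 1
      simp only [map_div₀, map_neg, map_mul, map_ofNat, Complex.conj_ofReal, Complex.conj_I,
        map_natCast]
      push_cast
      field_simp
      ring
    have hconj : (starRingEnd ℂ) (1 / (Real.sqrt (M * n : ℕ) : ℂ)) =
        1 / (Real.sqrt (M * n : ℕ) : ℂ) := by
      rw [map_div₀, map_one, Complex.conj_ofReal]
    rw [dftMatrix, Matrix.of_apply, map_mul, hconj, ← Complex.exp_conj, dftMatrix,
      Matrix.of_apply]
    linear_combination (1 / (Real.sqrt (M * n : ℕ) : ℂ)) * (1 / (Real.sqrt n : ℂ)) *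
      (χ ((l : ℕ) / n) : ℂ) * (χ ((b : ℕ) / n) : ℂ) * hexp
  rw [Finset.sum_congr rfl fun b _ => hterm b, ← Finset.mul_sum, norm_mul]
  rw [Finset.sum_range] at hbound
  refine le_trans ?_ hbound
  refine mul_le_of_le_one_left (norm_nonneg _) ?_
  have hph : ‖Complex.exp (-(2 * Real.pi * Complex.I * (-(j : ℕ) : ℤ) * (a : ℕ)) / (M : ℂ))‖ = 1 := by
    simpa using norm_exp_phase (-((j : ℕ) : ℤ)) ((a : ℕ) : ℤ) M
  have hs : ∀ m : ℕ, 0 < m → ‖(1 / (Real.sqrt m : ℂ))‖ ≤ 1 := by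
    intro m hm
    rw [norm_div, norm_one, Complex.norm_real, Real.norm_of_nonneg (Real.sqrt_nonneg _)]
    have : 1 ≤ Real.sqrt m := Real.one_le_sqrt.2 (by exact_mod_cast hm)
    exact (div_le_one (by positivity)).2 this
  have hχ1 : ‖(χ ((l : ℕ) / n) : ℂ)‖ ≤ 1 := by
    rw [Complex.norm_real, Real.norm_of_nonneg (hχ.mem_Icc _).1]
    exact (hχ.mem_Icc _).2
  rw [norm_mul, norm_mul, norm_mul, hph, mul_one]
  exact mul_le_one₀ (mul_le_one₀ (hs _ (by positivity)) (norm_nonneg _) (hs _ hn))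
    (norm_nonneg _) hχ1

/-! ### Euclidean contractions and the abstract eigenvalue inequality -/

section L2

variable {ι κ : Type*} [Fintype ι] [Fintype κ]

/-- The Euclidean norm of a family of complex numbers. -/
noncomputable def l2norm (v : ι → ℂ) : ℝ := ‖(WithLp.toLp 2 v : EuclideanSpace ℂ ι)‖

theorem l2norm_nonneg (v : ι → ℂ) : 0 ≤ l2norm v := norm_nonneg _

theorem l2norm_sq (v : ι → ℂ) : l2norm v ^ 2 = ∑ i, ‖v i‖ ^ 2 :=
  EuclideanSpace.norm_sq_eq _

theorem l2norm_add_le (v w : ι → ℂ) : l2norm (v + w) ≤ l2norm v + l2norm w := by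
  unfold l2norm
  rw [WithLp.toLp_add]
  exact norm_add_le _ _

theorem l2norm_smul (c : ℂ) (v : ι → ℂ) : l2norm (c • v) = ‖c‖ * l2norm v := by
  unfold l2norm
  rw [WithLp.toLp_smul, norm_smul]

theorem l2norm_pos {v : ι → ℂ} (hv : v ≠ 0) : 0 < l2norm v := by
  refine norm_pos_iff.2 fun h => hv ?_
  simpa using h

theorem l2norm_mono {v w : ι → ℂ} (h : ∀ i, ‖v i‖ ≤ ‖w i‖) : l2norm v ≤ l2norm w := by
  refine (sq_le_sq₀ (l2norm_nonneg v) (l2norm_nonneg w)).1 ?_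
  rw [l2norm_sq, l2norm_sq]
  exact Finset.sum_le_sum fun i _ => pow_le_pow_left₀ (norm_nonneg _) (h i) 2

theorem l2norm_indicator_le (s : Set ι) (v : ι → ℂ) : l2norm (s.indicator v) ≤ l2norm v :=
  l2norm_mono fun i => norm_indicator_le_norm_self v i

theorem l2norm_indicator_smul (s : Set ι) (c : ℂ) (v : ι → ℂ) :
    l2norm (s.indicator (c • v)) = ‖c‖ * l2norm (s.indicator v) := by
  rw [← l2norm_smul]
  congr 1
  ext i
  by_cases hi : i ∈ s <;> simp [hi]

theorem l2norm_zero : l2norm (0 : ι → ℂ) = 0 := by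
  simp [l2norm]

/-- Matrices of Euclidean operator norm at most one. -/
def IsContraction (T : Matrix ι ι ℂ) : Prop := ∀ v, l2norm (T.mulVec v) ≤ l2norm v

theorem IsContraction.zero : IsContraction (0 : Matrix ι ι ℂ) := by
  intro v
  refine l2norm_mono fun i => ?_
  simp

theorem IsContraction.mul {S T : Matrix ι ι ℂ} (hS : IsContraction S) (hT : IsContraction T) :
    IsContraction (S * T) := by
  intro v
  rw [← Matrix.mulVec_mulVec]
  exact (hS _).trans (hT v)

theorem IsContraction.diagonal [DecidableEq ι] {d : ι → ℂ} (hd : ∀ i, ‖d i‖ ≤ 1) :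
    IsContraction (Matrix.diagonal d) := by
  intro v
  refine l2norm_mono fun i => ?_
  rw [Matrix.mulVec_diagonal, norm_mul]
  exact mul_le_of_le_one_left (norm_nonneg _) (hd i)

theorem IsContraction.blockDiagonal [DecidableEq κ] {D : κ → Matrix ι ι ℂ}
    (hD : ∀ a, IsContraction (D a)) : IsContraction (Matrix.blockDiagonal D) := by
  intro v
  refine (sq_le_sq₀ (l2norm_nonneg _) (l2norm_nonneg v)).1 ?_
  rw [l2norm_sq, l2norm_sq, Fintype.sum_prod_type_right, Fintype.sum_prod_type_right]
  refine Finset.sum_le_sum fun a _ => ?_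
  have h := pow_le_pow_left₀ (l2norm_nonneg _) (hD a fun b => v (b, a)) 2
  rw [l2norm_sq, l2norm_sq] at h
  refine le_of_eq_of_le (Finset.sum_congr rfl fun b _ => ?_) h
  congr 2
  simp only [Matrix.mulVec, dotProduct, Fintype.sum_prod_type_right, Matrix.blockDiagonal_apply,
    ite_mul, zero_mul]
  rw [Finset.sum_eq_single a (by intro a' _ h; simp [h.symm]) (by simp)]
  simp

theorem IsContraction.reindex {T : Matrix ι ι ℂ} (hT : IsContraction T) (e : ι ≃ κ) :
    IsContraction (Matrix.reindex e e T) := by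
  intro v
  have hc (w : κ → ℂ) : l2norm (w ∘ e) = l2norm w := by
    refine (sq_eq_sq₀ (l2norm_nonneg _) (l2norm_nonneg _)).1 ?_
    rw [l2norm_sq, l2norm_sq]
    exact e.sum_comp fun i => ‖w i‖ ^ 2
  rw [← hc, ← hc v]
  convert hT (v ∘ e) using 2
  ext i
  simp only [Matrix.reindex_apply, Function.comp_apply, Matrix.mulVec, dotProduct,
    Matrix.submatrix_apply, Equiv.symm_apply_apply]
  rw [← e.sum_comp]
  simp

theorem l2norm_mulVec_of_isometry [DecidableEq ι] {U : Matrix ι ι ℂ} (hU : U.conjTranspose * U = 1)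
    (v : ι → ℂ) : l2norm (U.mulVec v) = l2norm v := by
  have hc (w : ι → ℂ) : ((l2norm w ^ 2 : ℝ) : ℂ) = star w ⬝ᵥ w := by
    rw [l2norm_sq]
    push_cast
    refine Finset.sum_congr rfl fun i _ => ?_
    rw [← Complex.conj_mul', Pi.star_apply, RCLike.star_def]
  refine (sq_eq_sq₀ (l2norm_nonneg _) (l2norm_nonneg _)).1 ?_
  apply Complex.ofReal_injective
  rw [hc, hc, Matrix.star_mulVec, Matrix.dotProduct_mulVec, Matrix.vecMul_vecMul, hU,
    Matrix.vecMul_one]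

theorem l2norm_le_of_norm_le_sum {v w : ι → ℂ} {η : ℝ} (hη : 0 ≤ η)
    (h : ∀ j, ‖w j‖ ≤ η * ∑ i, ‖v i‖) : l2norm w ≤ Fintype.card ι * η * l2norm v := by
  refine (sq_le_sq₀ (l2norm_nonneg w) (mul_nonneg (by positivity) (l2norm_nonneg v))).1 ?_
  rw [mul_pow, l2norm_sq, l2norm_sq]
  calc ∑ i, ‖w i‖ ^ 2 ≤ ∑ _i : ι, (η * ∑ i, ‖v i‖) ^ 2 :=
        Finset.sum_le_sum fun i _ => pow_le_pow_left₀ (norm_nonneg _) (h i) 2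
    _ = Fintype.card ι * η ^ 2 * (∑ i, ‖v i‖) ^ 2 := by
        rw [Finset.sum_const, nsmul_eq_mul, Finset.card_univ]; ring
    _ ≤ Fintype.card ι * η ^ 2 * (Fintype.card ι * ∑ i, ‖v i‖ ^ 2) := by
        gcongr
        exact sq_sum_le_card_mul_sum_sq
    _ = _ := by ring

/-- Split `v` along `Q`: the part on `Q` is handled by contraction, the rest by the entrywise bound.
-/
theorem l2norm_indicator_mulVec_le {T : Matrix ι ι ℂ} (hT : IsContraction T) {P Q : Set ι}
    {η : ℝ} (hη : 0 ≤ η) (h : ∀ j ∈ P, ∀ l ∉ Q, ‖T j l‖ ≤ η) (v : ι → ℂ) :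
    l2norm (P.indicator (T.mulVec v)) ≤
      l2norm (Q.indicator v) + Fintype.card ι * η * l2norm v := by
  have hsplit : P.indicator (T.mulVec v) =
      P.indicator (T.mulVec (Q.indicator v)) + P.indicator (T.mulVec (Qᶜ.indicator v)) := by
    rw [← Set.indicator_add', ← Matrix.mulVec_add, Set.indicator_self_add_compl]
  rw [hsplit]
  refine (l2norm_add_le _ _).trans (add_le_add ((l2norm_indicator_le _ _).trans (hT _)) ?_)
  refine l2norm_le_of_norm_le_sum hη fun j => ?_
  by_cases hj : j ∈ P
  · rw [Set.indicator_of_mem hj, Matrix.mulVec, dotProduct, Finset.mul_sum]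
    refine (norm_sum_le _ _).trans (Finset.sum_le_sum fun l _ => ?_)
    by_cases hl : l ∈ Q
    · rw [Set.indicator_of_notMem (by simpa using hl), mul_zero, norm_zero]
      positivity
    · rw [Set.indicator_of_mem (by simpa using hl), norm_mul]
      exact mul_le_mul_of_nonneg_right (h j hj l hl) (norm_nonneg _)
  · rw [Set.indicator_of_notMem hj, norm_zero]
    positivity

theorem IsContraction.norm_eigenvalue_le {B : Matrix ι ι ℂ} (hB : IsContraction B) {z : ℂ}
    {u : ι → ℂ} (hu : u ≠ 0) (hz : B.mulVec u = z • u) : ‖z‖ ≤ 1 := by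
  have := hB u
  rw [hz, l2norm_smul] at this
  exact le_of_mul_le_mul_right (by linarith) (l2norm_pos hu)

/-- If `B` nearly maps functions supported off `X (i + 1)` to functions supported off `X i`, then
eigenfunctions of `B` concentrate on `X m` and their Fourier transforms are localized to `X m`,
so the norm of the Fourier transform between functions on `X m` controls the eigenvalues. -/
theorem eigenvalue_bound [DecidableEq ι] {B F G : Matrix ι ι ℂ} (hB : IsContraction B)
    (hBT : IsContraction B.transpose) (hF : ∀ v, l2norm (F.mulVec v) = l2norm v)
    (hGF : G * F = 1) (hFB : B.transpose * F = F * B)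
    {z : ℂ} {u : ι → ℂ} (hu : u ≠ 0) (hz : B.mulVec u = z • u)
    {X : ℕ → Set ι} (hX0 : X 0 = Set.univ) {m : ℕ} {η ρ : ℝ} (hη : 0 ≤ η)
    (hX : ∀ i < m, ∀ j ∈ X i, ∀ l ∉ X (i + 1), ‖B j l‖ ≤ η) (hG : IsContraction G)
    (hρ : ∀ v, l2norm ((X m).indicator (G.mulVec ((X m).indicator v))) ≤ ρ * l2norm v) :
    ‖z‖ ^ (2 * m) ≤ ‖z‖ ^ m * ρ + 2 * m * (Fintype.card ι * η) := by
  have hu0 := l2norm_pos hu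
  have hz1 := hB.norm_eigenvalue_le hu hz
  have hz0 := norm_nonneg z
  set v := F.mulVec u with hv
  have hvu : l2norm v = l2norm u := hF u
  have hBv : B.transpose.mulVec v = z • v := by
    rw [hv, Matrix.mulVec_mulVec, hFB, ← Matrix.mulVec_mulVec, hz, Matrix.mulVec_smul]
  have hGv : G.mulVec v = u := by rw [hv, Matrix.mulVec_mulVec, hGF, Matrix.one_mulVec]
  set κ := Fintype.card ι * η * l2norm u with hκ
  have hκ0 : 0 ≤ κ := by positivity
  -- Restricting `B u = z u` to `X i` bounds `|z|` times the mass of `u` there by its mass on `X (i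
  -- + 1)`, up to `κ`.
  have h1 : ∀ i ≤ m, ‖z‖ ^ i * l2norm u ≤ l2norm ((X i).indicator u) + i * κ := by
    intro i
    induction i with
    | zero => intro _; simp [hX0]
    | succ i ih =>
      intro hi
      have h := ih (by omega)
      have hstep := l2norm_indicator_mulVec_le hB hη (hX i (by omega)) u
      rw [hz, l2norm_indicator_smul] at hstep
      have h2 : ‖z‖ * (‖z‖ ^ i * l2norm u) ≤ ‖z‖ * (l2norm ((X i).indicator u) + i * κ) :=
        mul_le_mul_of_nonneg_left h hz0
      have h3 : ‖z‖ * (i * κ) ≤ i * κ := mul_le_of_le_one_left (by positivity) hz1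
      rw [pow_succ']
      push_cast
      linarith
  -- The transposed relation runs on complements, starting from the empty complement of `X 0`. The
  -- power of `|z|` stays on the left to avoid dividing by it.
  have h2 : ∀ i ≤ m, ‖z‖ ^ i * l2norm ((X i)ᶜ.indicator v) ≤ i * κ := by
    intro i
    induction i with
    | zero =>
      intro _
      rw [hX0, Set.compl_univ, Set.indicator_empty', l2norm_zero]
      simp
    | succ i ih =>
      intro hi
      have h := ih (by omega)
      have hstep := l2norm_indicator_mulVec_le hBT (P := (X (i + 1))ᶜ) (Q := (X i)ᶜ) hη
        (fun j hj l hl => hX i (by omega) l (by simpa using hl) j hj) v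
      rw [hBv, l2norm_indicator_smul, hvu] at hstep
      have h2 := mul_le_mul_of_nonneg_left hstep (pow_nonneg hz0 i)
      have h3 : ‖z‖ ^ i * κ ≤ κ := mul_le_of_le_one_left hκ0 (pow_le_one₀ hz0 hz1)
      rw [pow_succ]
      push_cast
      linarith
  have h3 : l2norm ((X m).indicator u) ≤ ρ * l2norm u + l2norm ((X m)ᶜ.indicator v) := by
    have hsplit : (X m).indicator u = (X m).indicator (G.mulVec ((X m).indicator v)) +
        (X m).indicator (G.mulVec ((X m)ᶜ.indicator v)) := by
      rw [← Set.indicator_add', ← Matrix.mulVec_add, Set.indicator_self_add_compl, hGv]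
    rw [hsplit]
    refine (l2norm_add_le _ _).trans (add_le_add ?_ ?_)
    · rw [← hvu]; exact hρ v
    · exact (l2norm_indicator_le _ _).trans (hG _)
  have h4 := h1 m le_rfl
  have h5 := h2 m le_rfl
  have h6 : ‖z‖ ^ m * (‖z‖ ^ m * l2norm u) ≤
      ‖z‖ ^ m * (ρ * l2norm u + l2norm ((X m)ᶜ.indicator v) + m * κ) :=
    mul_le_mul_of_nonneg_left (by linarith) (pow_nonneg hz0 m)
  have h7 : ‖z‖ ^ m * (m * κ) ≤ m * κ :=
    mul_le_of_le_one_left (by positivity) (pow_le_one₀ hz0 hz1)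
  refine le_of_mul_le_mul_right ?_ hu0
  rw [two_mul, pow_add]
  rw [hκ] at *
  linarith

end L2

/-! ### Contraction and transpose symmetry of the open quantum map -/

theorem dftMatrix_conjTranspose_mul {N : ℕ} (hN : N ≠ 0) :
    (dftMatrix N).conjTranspose * dftMatrix N = 1 :=
  mul_eq_one_comm.1 (dftMatrix_mul_conjTranspose hN)

theorem isContraction_dftMatrix {N : ℕ} (hN : N ≠ 0) : IsContraction (dftMatrix N) := fun v =>
  (l2norm_mulVec_of_isometry (dftMatrix_conjTranspose_mul hN) v).le

theorem isContraction_dftMatrix_inv {N : ℕ} (hN : N ≠ 0) : IsContraction (dftMatrix N)⁻¹ := by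
  intro v
  rw [dftMatrix_inv hN]
  refine (l2norm_mulVec_of_isometry ?_ v).le
  rw [Matrix.conjTranspose_conjTranspose]
  exact dftMatrix_mul_conjTranspose hN

theorem IsCutoff.isContraction_cutoffMatrix {χ : ℝ → ℝ} (hχ : IsCutoff χ) (n : ℕ) :
    IsContraction (cutoffMatrix χ n) := by
  refine IsContraction.diagonal fun i => ?_
  rw [Complex.norm_real, Real.norm_of_nonneg (hχ.mem_Icc _).1]
  exact (hχ.mem_Icc _).2

/-- The block diagonal factor of the open quantum map. -/
noncomputable def blockFactor (M n : ℕ) (𝒜 : Finset (Fin M)) (χ : ℝ → ℝ) :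
    Matrix (Fin (M * n)) (Fin (M * n)) ℂ :=
  Matrix.reindex (blockIndex M n) (blockIndex M n)
    (Matrix.blockDiagonal fun a : Fin M =>
      if a ∈ 𝒜 then cutoffMatrix χ n * dftMatrix n * cutoffMatrix χ n else 0)

theorem openQuantumMap_eq (M n : ℕ) (𝒜 : Finset (Fin M)) (χ : ℝ → ℝ) :
    openQuantumMap M n 𝒜 χ = (dftMatrix (M * n))⁻¹ * blockFactor M n 𝒜 χ := rfl

/-- Each block `χ F χ` is symmetric, though not Hermitian, because `F` is symmetric. This is why the
transpose, and not the adjoint, intertwines with `B` through `F`. -/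
theorem blockFactor_transpose (M n : ℕ) (𝒜 : Finset (Fin M)) (χ : ℝ → ℝ) :
    (blockFactor M n 𝒜 χ).transpose = blockFactor M n 𝒜 χ := by
  rw [blockFactor, Matrix.transpose_reindex, Matrix.blockDiagonal_transpose]
  congr 2
  funext a
  split_ifs
  · rw [Matrix.transpose_mul, Matrix.transpose_mul, dftMatrix_transpose, cutoffMatrix,
      Matrix.diagonal_transpose, Matrix.mul_assoc]
  · exact Matrix.transpose_zero

theorem IsCutoff.isContraction_blockFactor {χ : ℝ → ℝ} (hχ : IsCutoff χ) {M n : ℕ} (hn : n ≠ 0)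
    (𝒜 : Finset (Fin M)) : IsContraction (blockFactor M n 𝒜 χ) := by
  refine IsContraction.reindex (IsContraction.blockDiagonal fun a => ?_) _
  split_ifs
  · exact ((hχ.isContraction_cutoffMatrix n).mul (isContraction_dftMatrix hn)).mul
      (hχ.isContraction_cutoffMatrix n)
  · exact IsContraction.zero

theorem openQuantumMap_transpose (M n : ℕ) (𝒜 : Finset (Fin M)) (χ : ℝ → ℝ) :
    (openQuantumMap M n 𝒜 χ).transpose = blockFactor M n 𝒜 χ * (dftMatrix (M * n))⁻¹ := by
  rw [openQuantumMap_eq, Matrix.transpose_mul, blockFactor_transpose,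
    Matrix.transpose_nonsing_inv, dftMatrix_transpose]

theorem IsCutoff.isContraction_openQuantumMap {χ : ℝ → ℝ} (hχ : IsCutoff χ) {M n : ℕ}
    (hM : M ≠ 0) (hn : n ≠ 0) (𝒜 : Finset (Fin M)) : IsContraction (openQuantumMap M n 𝒜 χ) :=
  (isContraction_dftMatrix_inv (mul_ne_zero hM hn)).mul (hχ.isContraction_blockFactor hn 𝒜)

theorem IsCutoff.isContraction_openQuantumMap_transpose {χ : ℝ → ℝ} (hχ : IsCutoff χ) {M n : ℕ}
    (hM : M ≠ 0) (hn : n ≠ 0) (𝒜 : Finset (Fin M)) :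
    IsContraction (openQuantumMap M n 𝒜 χ).transpose := by
  rw [openQuantumMap_transpose]
  exact (hχ.isContraction_blockFactor hn 𝒜).mul (isContraction_dftMatrix_inv (mul_ne_zero hM hn))

theorem exists_eigenvector {ι : Type*} [Fintype ι] [DecidableEq ι] {B : Matrix ι ι ℂ} {z : ℂ}
    (hz : z ∈ spectrum ℂ B) : ∃ u : ι → ℂ, u ≠ 0 ∧ B.mulVec u = z • u := by
  rw [spectrum.mem_iff, Matrix.isUnit_iff_isUnit_det, isUnit_iff_ne_zero, not_not] at hz
  obtain ⟨u, hu, h⟩ := Matrix.exists_mulVec_eq_zero_iff.2 hz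
  refine ⟨u, hu, ?_⟩
  rw [Matrix.sub_mulVec, sub_eq_zero, Algebra.algebraMap_eq_smul_one, Matrix.smul_mulVec,
    Matrix.one_mulVec] at h
  exact h.symm

/-- The inverse transform has the conjugate kernel; conjugating the input vector reduces it to
`fourierKernel`. -/
theorem FourierBound.l2norm_le {N : ℕ} (hN : N ≠ 0) {Z : Finset ℤ} {r : ℝ}
    (h : FourierBound N Z Z r) (hr : 0 ≤ r) {X : Set (Fin N)}
    (hX : ∀ l : Fin N, ((l : ℕ) : ℤ) ∈ Z ↔ l ∈ X) (hZ : ∀ z ∈ Z, 0 ≤ z ∧ z < N) (v : Fin N → ℂ) :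
    l2norm (X.indicator ((dftMatrix N)⁻¹.mulVec (X.indicator v))) ≤ r * l2norm v := by
  classical
  refine ((sq_le_sq₀ (l2norm_nonneg _) (mul_nonneg hr (l2norm_nonneg (X.indicator v)))).1 ?_).trans
    (mul_le_mul_of_nonneg_left (l2norm_indicator_le _ _) hr)
  set w : ℤ → ℂ := fun l =>
    if hl : 0 ≤ l ∧ l < N then (starRingEnd ℂ) (v ⟨l.toNat, by omega⟩) else 0 with hw
  have hwl : ∀ l : Fin N, w (l : ℕ) = (starRingEnd ℂ) (v l) := by
    intro l
    have : (0 : ℤ) ≤ (l : ℕ) ∧ ((l : ℕ) : ℤ) < N := ⟨by positivity, by exact_mod_cast l.2⟩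
    simp only [hw, dif_pos this, Int.toNat_natCast, Fin.eta]
  have hsum {E : Type} [AddCommMonoid E] (f : ℤ → E) :
      ∑ l ∈ Z, f l = ∑ l : Fin N, X.indicator (fun l => f (l : ℕ)) l := by
    simp only [Set.indicator_apply]
    rw [← Finset.sum_filter]
    symm
    refine Finset.sum_bij (fun l _ => ((l : ℕ) : ℤ)) ?_ ?_ ?_ ?_
    · intro l hl
      exact (hX l).2 (Finset.mem_filter.1 hl).2
    · intro a _ b _ hab
      exact Fin.ext (by simpa using hab)
    · intro b hb
      obtain ⟨h0, h1⟩ := hZ b hb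
      have hb' : ((b.toNat : ℕ) : ℤ) = b := Int.toNat_of_nonneg h0
      refine ⟨⟨b.toNat, by omega⟩, ?_, hb'⟩
      refine Finset.mem_filter.2 ⟨Finset.mem_univ _, (hX _).1 ?_⟩
      simpa only [hb'] using hb
    · intros; rfl
  have hent : ∀ j : Fin N, ‖((dftMatrix N)⁻¹.mulVec (X.indicator v)) j‖ =
      ‖∑ l ∈ Z, fourierKernel N (j : ℕ) l * w l‖ := by
    intro j
    rw [hsum, ← RCLike.norm_conj, Matrix.mulVec, dotProduct, map_sum]
    congr 1
    refine Finset.sum_congr rfl fun l _ => ?_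
    by_cases hl : l ∈ X
    · rw [Set.indicator_of_mem hl, Set.indicator_of_mem hl, hwl, map_mul, dftMatrix_inv hN,
        Matrix.conjTranspose_apply, RCLike.star_def, Complex.conj_conj, dftMatrix_apply,
        fourierKernel_comm]
    · rw [Set.indicator_of_notMem hl, Set.indicator_of_notMem hl, mul_zero, map_zero]
  have hb := h w
  rw [mul_pow, l2norm_sq, l2norm_sq]
  rw [hsum, hsum] at hb
  refine le_of_eq_of_le ?_ (hb.trans_eq ?_)
  · refine Finset.sum_congr rfl fun j _ => ?_
    by_cases hj : j ∈ X
    · rw [Set.indicator_of_mem hj, Set.indicator_of_mem hj, hent]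
    · rw [Set.indicator_of_notMem hj, Set.indicator_of_notMem hj]
      simp
  · congr 1
    refine Finset.sum_congr rfl fun j _ => ?_
    by_cases hj : j ∈ X
    · rw [Set.indicator_of_mem hj, Set.indicator_of_mem hj, hwl, RCLike.norm_conj]
    · rw [Set.indicator_of_notMem hj, Set.indicator_of_notMem hj]
      simp

/-! ### Propagation along neighbourhoods of the Cantor set -/

/-- The points of `{0, …, N - 1}` within distance `2 W` of the `i`-th generation intervals
of the Cantor set. -/
def cantorNbhd (M : ℕ) (𝒜 : Finset (Fin M)) (k W i : ℕ) : Set (Fin (M * M ^ k)) :=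
  {l | ∃ c ∈ digitCantorSet M 𝒜 i, c * (M : ℤ) ^ (k + 1 - i) - 2 * W ≤ (l : ℕ) ∧
    ((l : ℕ) : ℤ) ≤ (c + 1) * (M : ℤ) ^ (k + 1 - i) + 2 * W}

theorem cantorNbhd_zero (M : ℕ) (𝒜 : Finset (Fin M)) (k W : ℕ) :
    cantorNbhd M 𝒜 k W 0 = Set.univ := by
  refine Set.eq_univ_of_forall fun l => ⟨0, by simp [digitCantorSet], by simp; omega, ?_⟩
  have : ((l : ℕ) : ℤ) < ((M * M ^ k : ℕ) : ℤ) := by exact_mod_cast l.2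
  push_cast at this
  rw [Nat.sub_zero, pow_succ']
  linarith

/-- Going from `j` to `l ≈ j / M` shrinks the interval by `M`, and block `a` prepends the digit `a`.
The margin `2 W` is preserved because `2 W / M + W ≤ 2 W` for `M ≥ 2`. -/
theorem blockIndex_mem_cantorNbhd {M : ℕ} (hM : 2 ≤ M) {𝒜 : Finset (Fin M)} {k W i : ℕ}
    (hi : i ≤ k) {j : Fin (M * M ^ k)} (hj : j ∈ cantorNbhd M 𝒜 k W i) {a : Fin M} (ha : a ∈ 𝒜)
    {l : Fin (M ^ k)} (h : |((j : ℕ) : ℤ) - M * (l : ℕ)| ≤ M * W) :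
    blockIndex M (M ^ k) (l, a) ∈ cantorNbhd M 𝒜 k W (i + 1) := by
  obtain ⟨c, hc, h1, h2⟩ := hj
  refine ⟨_, mem_cantorSet_succ.2 ⟨a, ha, c, hc, rfl⟩, ?_⟩
  obtain ⟨d, rfl⟩ := Nat.exists_eq_add_of_le hi
  rw [show i + d + 1 - i = d + 1 by omega, pow_succ] at h1 h2
  rw [show i + d + 1 - (i + 1) = d by omega, blockIndex_val]
  push_cast
  rw [abs_le] at h
  obtain ⟨h3, h4⟩ := h
  have hM' : (2 : ℤ) ≤ M := by exact_mod_cast hM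
  have hW : (0 : ℤ) ≤ W := by positivity
  have hMW : 2 * (W : ℤ) ≤ M * W := mul_le_mul_of_nonneg_right hM' hW
  have hM0 : (0 : ℤ) < M := by linarith
  have e : (M : ℤ) ^ (i + d) = (M : ℤ) ^ i * (M : ℤ) ^ d := pow_add _ _ _
  have k1 : c * (M : ℤ) ^ d - 2 * W ≤ (l : ℕ) := by
    refine le_of_mul_le_mul_left ?_ hM0
    linarith
  have k2 : ((l : ℕ) : ℤ) ≤ (c + 1) * (M : ℤ) ^ d + 2 * W := by
    refine le_of_mul_le_mul_left ?_ hM0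
    linarith
  rw [e]
  constructor <;> linarith

/-- With `W = M ^ p`, the intervals of generation `k + 1 - p` have length `W`. Appending a fixed
tail `e` of `p` digits gives a point of the full Cantor set within `3 W`, so `6 W + 1 ≤ 7 W`
translates cover the neighbourhood. -/
theorem FourierBound.cantorNbhd {M : ℕ} (hM : 2 ≤ M) {𝒜 : Finset (Fin M)} (h𝒜 : 𝒜.Nonempty)
    {r : ℝ} (hr : 0 ≤ r) (h : FourierBound M (digitSet M 𝒜) (digitSet M 𝒜) r) {k p : ℕ}
    (hp : p ≤ k + 1) (v : Fin (M * M ^ k) → ℂ) :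
    l2norm ((cantorNbhd M 𝒜 k (M ^ p) (k + 1 - p)).indicator ((dftMatrix (M * M ^ k))⁻¹.mulVec
      ((cantorNbhd M 𝒜 k (M ^ p) (k + 1 - p)).indicator v))) ≤
      (7 * (M : ℝ) ^ p * r ^ (k + 1)) * l2norm v := by
  classical
  set X := _root_.cantorNbhd M 𝒜 k (M ^ p) (k + 1 - p) with hX
  set Z : Finset ℤ := (Finset.univ.filter (· ∈ X)).image fun l : Fin (M * M ^ k) => ((l : ℕ) : ℤ)
    with hZ
  have hM0 : 0 < M := by omega
  set W : ℕ := M ^ p with hW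
  have hW1 : 1 ≤ W := Nat.one_le_pow _ _ hM0
  obtain ⟨e, he⟩ := cantorSet_nonempty h𝒜 p
  obtain ⟨he0, he1⟩ := cantorSet_bounds he
  have hcov : ∀ z ∈ Z, ∃ s ∈ Finset.Icc (-(3 * W : ℤ)) (3 * W), z - s ∈ digitCantorSet M 𝒜 (k + 1) := by
    intro z hz
    obtain ⟨l, hl, rfl⟩ := Finset.mem_image.1 hz
    obtain ⟨c, hc, h1, h2⟩ := (Finset.mem_filter.1 hl).2
    have happ := cantorSet_append he hc
    rw [Nat.sub_add_cancel hp] at happ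
    rw [show k + 1 - (k + 1 - p) = p by omega] at h1 h2
    have hWz : (M : ℤ) ^ p = W := by rw [hW]; push_cast; rfl
    rw [hWz] at h1 h2 he1 happ
    refine ⟨(l : ℕ) - (c * W + e), ?_, by rwa [sub_sub_cancel]⟩
    rw [Finset.mem_Icc]
    constructor <;> linarith
  have hb := FourierBound.of_covering (h.pow (by omega) (k + 1)) hcov
  rw [pow_succ'] at hb
  have hl := FourierBound.l2norm_le (X := X) (by positivity) hb (by positivity) (fun l => by
    simp only [hZ, Finset.mem_image, Finset.mem_filter, Finset.mem_univ, true_and]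
    constructor
    · rintro ⟨l', hl', heq⟩
      rwa [show l = l' from Fin.ext (by simpa using heq.symm)]
    · intro hl
      exact ⟨l, hl, rfl⟩) (fun z hz => by
    obtain ⟨l, -, rfl⟩ := Finset.mem_image.1 hz
    exact ⟨by positivity, by exact_mod_cast l.2⟩) v
  refine hl.trans (mul_le_mul_of_nonneg_right ?_ (l2norm_nonneg v))
  refine mul_le_mul_of_nonneg_right ?_ (by positivity)
  have hcard : (Finset.Icc (-(3 * W : ℤ)) (3 * W)).card = 6 * W + 1 := by
    rw [Int.card_Icc]; omega
  rw [hcard]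
  have : (1 : ℝ) ≤ W := by exact_mod_cast hW1
  have hWr : (M : ℝ) ^ p = W := by rw [hW]; push_cast; rfl
  rw [hWr]
  push_cast
  linarith

/-- The eigenvalue inequality at scale `N = M ^ (k + 1)`, with localization at width `M ^ p`. -/
theorem IsCutoff.eigenvalue_le {χ : ℝ → ℝ} (hχ : IsCutoff χ) (K : ℕ) :
    ∃ C : ℝ, 0 < C ∧ ∀ M : ℕ, 2 ≤ M → ∀ 𝒜 : Finset (Fin M), 𝒜.Nonempty → ∀ r : ℝ, 0 ≤ r →
      FourierBound M (digitSet M 𝒜) (digitSet M 𝒜) r → ∀ k p : ℕ, p ≤ k + 1 →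
      ∀ z ∈ spectrum ℂ (openQuantumMap M (M ^ k) 𝒜 χ),
        ‖z‖ ^ (2 * (k + 1 - p)) ≤ ‖z‖ ^ (k + 1 - p) * (7 * (M : ℝ) ^ p * r ^ (k + 1)) +
          2 * ((k + 1 - p : ℕ) : ℝ) * ((M : ℝ) ^ (k + 1) * (C * (M : ℝ) ^ k / ((M : ℝ) ^ p) ^ K)) := by
  obtain ⟨C, hC0, hC⟩ := hχ.exists_norm_openQuantumMap_le K
  refine ⟨C, hC0, fun M hM 𝒜 h𝒜 r hr hb k p hp z hz => ?_⟩
  obtain ⟨u, hu, hzu⟩ := exists_eigenvector hz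
  have hM0 : M ≠ 0 := by omega
  have hMpos : (0 : ℝ) < M := by positivity
  have hn0 : M ^ k ≠ 0 := pow_ne_zero _ hM0
  have hN0 := mul_ne_zero hM0 hn0
  have hdet : (dftMatrix (M * M ^ k))⁻¹ * dftMatrix (M * M ^ k) = 1 := by
    rw [dftMatrix_inv hN0, dftMatrix_conjTranspose_mul hN0]
  have hdet' : dftMatrix (M * M ^ k) * (dftMatrix (M * M ^ k))⁻¹ = 1 := by
    rw [dftMatrix_inv hN0, dftMatrix_mul_conjTranspose hN0]
  have := eigenvalue_bound (hχ.isContraction_openQuantumMap hM0 hn0 𝒜)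
    (hχ.isContraction_openQuantumMap_transpose hM0 hn0 𝒜)
    (l2norm_mulVec_of_isometry (dftMatrix_conjTranspose_mul hN0)) hdet
    (by rw [openQuantumMap_transpose, openQuantumMap_eq, Matrix.mul_assoc, hdet, Matrix.mul_one,
          ← Matrix.mul_assoc, hdet', Matrix.one_mul]) hu hzu
    (X := cantorNbhd M 𝒜 k (M ^ p)) (cantorNbhd_zero _ _ _ _) (m := k + 1 - p)
    (η := C * (M : ℝ) ^ k / ((M : ℝ) ^ p) ^ K) (by positivity) ?_
    (isContraction_dftMatrix_inv hN0) (FourierBound.cantorNbhd hM h𝒜 hr hb hp)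
  · rw [Fintype.card_fin] at this
    convert this using 4
    push_cast
    ring
  · intro i hi j hj l hl
    obtain ⟨⟨l', a⟩, rfl⟩ := (blockIndex M (M ^ k)).surjective l
    by_cases ha : a ∈ 𝒜
    · have hfar := mt (blockIndex_mem_cantorNbhd hM (by omega) hj ha) hl
      rw [not_le] at hfar
      have := hC M (M ^ k) (by omega) (by positivity) 𝒜 ((M : ℝ) ^ p) (by positivity) j l' a (by
        have h2 : ((M * (M ^ p : ℕ) : ℤ) : ℝ) < ((|((j : ℕ) : ℤ) - M * (l' : ℕ)| : ℤ) : ℝ) := by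
          exact_mod_cast hfar
        push_cast at h2
        exact h2.le)
      push_cast at this
      exact this
    · rw [openQuantumMap_apply hM0 hn0, if_neg ha, norm_zero]
      positivity

/-! ### Choice of scales and the spectral gap -/

/-- This rules out eigenvalues of modulus in `[s, 1]`. Taking `p = k / q` with `q` large makes the
covering loss `M ^ p` smaller than `(s / r) ^ k`. Then the decay order `K = q L` is taken so that `M
^ (p K)`, about `M ^ (L k)`, beats `(M ^ 2 / s ^ 2) ^ k`. Each term on the left is then at most half
of the right side, the second strictly less. -/
theorem exists_scales {M : ℕ} (hM : 2 ≤ M) {r s : ℝ} (hr : 0 < r) (hrs : r < s) (hs : s < 1) :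
    ∃ q K : ℕ, ∀ C : ℝ, 0 < C → ∀ᶠ k : ℕ in atTop, ∀ t : ℝ, s ≤ t → t ≤ 1 →
      t ^ (k + 1 - k / q) * (7 * (M : ℝ) ^ (k / q) * r ^ (k + 1)) +
          2 * ((k + 1 - k / q : ℕ) : ℝ) *
            ((M : ℝ) ^ (k + 1) * (C * (M : ℝ) ^ k / ((M : ℝ) ^ (k / q)) ^ K)) <
        t ^ (2 * (k + 1 - k / q)) := by
  have hM1 : (1 : ℝ) < M := by exact_mod_cast (show 1 < M by omega)
  have hM0 : (0 : ℝ) < M := by linarith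
  have hs0 : 0 < s := hr.trans hrs
  obtain ⟨x, hx1, hx2⟩ := exists_between ((one_lt_div hr).2 hrs)
  have hx0 : 0 < x := by linarith
  obtain ⟨q, hq⟩ := pow_unbounded_of_one_lt (M : ℝ) hx1
  have hq0 : 0 < q := by
    rcases Nat.eq_zero_or_pos q with h | h
    · rw [h, pow_zero] at hq; linarith
    · exact h
  obtain ⟨L, hL⟩ := pow_unbounded_of_one_lt ((M : ℝ) ^ 2 / s ^ 2) hM1
  refine ⟨q, q * L, fun C hC => ?_⟩
  set y : ℝ := (M : ℝ) ^ 2 / s ^ 2 / (M : ℝ) ^ L with hy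
  have hy0 : 0 ≤ y := by positivity
  have hy1 : y < 1 := (div_lt_one (by positivity)).2 hL
  have hxr : x * r / s < 1 := by
    rw [div_lt_one hs0]
    exact (lt_div_iff₀ hr).1 hx2
  have ev1 : ∀ᶠ k : ℕ in atTop, 14 * r * (x * r / s) ^ k < s := by
    have := (tendsto_pow_atTop_nhds_zero_of_lt_one (by positivity) hxr).const_mul (14 * r)
    rw [mul_zero] at this
    exact this.eventually (gt_mem_nhds hs0)
  have ev2 : ∀ᶠ k : ℕ in atTop,
      4 * C * M * (M : ℝ) ^ (q * L) * ((k : ℝ) * y ^ k + y ^ k) < s ^ 2 := by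
    have h1 := (tendsto_self_mul_const_pow_of_lt_one hy0 hy1).add
      (tendsto_pow_atTop_nhds_zero_of_lt_one hy0 hy1)
    have := h1.const_mul (4 * C * M * (M : ℝ) ^ (q * L))
    rw [add_zero, mul_zero] at this
    exact this.eventually (gt_mem_nhds (by positivity))
  filter_upwards [ev1, ev2] with k h1 h2 t hst ht1
  set p := k / q with hp
  set m := k + 1 - p with hm
  have hpk : q * p ≤ k := Nat.mul_div_le k q
  have hpk' : k ≤ q * p + q := by
    have := Nat.div_add_mod k q
    have := Nat.mod_lt k hq0
    rw [← hp] at *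
    omega
  have hmk : m ≤ k + 1 := Nat.sub_le _ _
  have ht0 : 0 < t := hs0.trans_le hst
  have hMp : (M : ℝ) ^ p ≤ x ^ k := by
    calc (M : ℝ) ^ p ≤ (x ^ q) ^ p := by gcongr
      _ = x ^ (q * p) := (pow_mul _ _ _).symm
      _ ≤ x ^ k := pow_le_pow_right₀ hx1.le hpk
  have htm : s ^ (k + 1) ≤ t ^ m :=
    (pow_le_pow_left₀ hs0.le hst _).trans (pow_le_pow_of_le_one ht0.le ht1 hmk)
  have hfirst : 14 * ((M : ℝ) ^ p * r ^ (k + 1)) ≤ s ^ (k + 1) := by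
    calc 14 * ((M : ℝ) ^ p * r ^ (k + 1)) ≤ 14 * (x ^ k * r ^ (k + 1)) := by gcongr
      _ = (14 * r * (x * r / s) ^ k) * s ^ k := by
        rw [div_pow, mul_pow]; field_simp; ring
      _ ≤ s * s ^ k := by gcongr
      _ = s ^ (k + 1) := by ring
  have ht2 : t ^ (2 * m) = t ^ m * t ^ m := by rw [two_mul, pow_add]
  have hA : t ^ m * (7 * (M : ℝ) ^ p * r ^ (k + 1)) ≤ t ^ (2 * m) / 2 := by
    rw [ht2, mul_div_assoc]
    refine mul_le_mul_of_nonneg_left ?_ (by positivity)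
    linarith
  have hB : 2 * (m : ℝ) * ((M : ℝ) ^ (k + 1) * (C * (M : ℝ) ^ k / ((M : ℝ) ^ p) ^ (q * L))) <
      t ^ (2 * m) / 2 := by
    have hlow : s ^ 2 * (s ^ 2) ^ k ≤ t ^ (2 * m) := by
      rw [ht2]
      calc s ^ 2 * (s ^ 2) ^ k = s ^ (k + 1) * s ^ (k + 1) := by ring
        _ ≤ _ := by gcongr
    have hpow : ((M : ℝ) ^ L) ^ k ≤ ((M : ℝ) ^ p) ^ (q * L) * (M : ℝ) ^ (q * L) := by
      rw [← pow_mul, ← pow_mul, ← pow_add]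
      refine pow_le_pow_right₀ hM1.le ?_
      calc L * k ≤ L * (q * p + q) := Nat.mul_le_mul_left _ hpk'
        _ = p * (q * L) + q * L := by ring
    have hinv : 1 / ((M : ℝ) ^ p) ^ (q * L) ≤ (M : ℝ) ^ (q * L) / ((M : ℝ) ^ L) ^ k := by
      rw [div_le_div_iff₀ (by positivity) (by positivity)]
      linarith
    have hm' : (m : ℝ) ≤ k + 1 := by exact_mod_cast hmk
    calc 2 * (m : ℝ) * ((M : ℝ) ^ (k + 1) * (C * (M : ℝ) ^ k / ((M : ℝ) ^ p) ^ (q * L)))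
        = 2 * (m : ℝ) * C * M * ((M : ℝ) ^ 2) ^ k * (1 / ((M : ℝ) ^ p) ^ (q * L)) := by ring
      _ ≤ 2 * ((k : ℝ) + 1) * C * M * ((M : ℝ) ^ 2) ^ k *
            ((M : ℝ) ^ (q * L) / ((M : ℝ) ^ L) ^ k) := by gcongr
      _ = (4 * C * M * (M : ℝ) ^ (q * L) * ((k : ℝ) * y ^ k + y ^ k)) * (s ^ 2) ^ k / 2 := by
          rw [hy, div_pow, div_pow]
          field_simp
          ring
      _ < s ^ 2 * (s ^ 2) ^ k / 2 := by gcongr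
      _ ≤ t ^ (2 * m) / 2 := by linarith
  linarith

theorem IsCutoff.spectralRadius_le_one {χ : ℝ → ℝ} (hχ : IsCutoff χ) {M n : ℕ} (hM : M ≠ 0)
    (hn : n ≠ 0) (𝒜 : Finset (Fin M)) : spectralRadius ℂ (openQuantumMap M n 𝒜 χ) ≤ 1 := by
  refine iSup₂_le fun z hz => ?_
  obtain ⟨u, hu, hzu⟩ := exists_eigenvector hz
  have := (hχ.isContraction_openQuantumMap hM hn 𝒜).norm_eigenvalue_le hu hzu
  exact_mod_cast this

/-- The open quantum map is a contraction, so its spectral radius never exceeds `1 ≤ M ^ (-β)`. -/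
theorem IsCutoff.hasSpectralGap_of_nonpos {χ : ℝ → ℝ} (hχ : IsCutoff χ) {M : ℕ} (hM : M ≠ 0)
    (𝒜 : Finset (Fin M)) {β : ℝ} (hβ : β ≤ 0) : HasSpectralGap M 𝒜 χ β := by
  have h1 : (1 : ENNReal) ≤ ENNReal.ofReal ((M : ℝ) ^ (-β)) := by
    rw [ENNReal.one_le_ofReal]
    exact Real.one_le_rpow (by exact_mod_cast Nat.one_le_iff_ne_zero.2 hM) (by linarith)
  refine le_trans ?_ h1
  exact limsup_le_of_le (h := Eventually.of_forall fun k =>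
    hχ.spectralRadius_le_one hM (pow_ne_zero _ hM) 𝒜)

/-- A fractal uncertainty principle for the alphabet implies a spectral gap. -/
theorem IsCutoff.hasSpectralGap_of_fourierBound {χ : ℝ → ℝ} (hχ : IsCutoff χ) {M : ℕ} (hM : 2 ≤ M)
    {𝒜 : Finset (Fin M)} (h𝒜 : 𝒜.Nonempty) {β : ℝ}
    (h : FourierBound M (digitSet M 𝒜) (digitSet M 𝒜) ((M : ℝ) ^ (-β))) :
    HasSpectralGap M 𝒜 χ β := by
  have hM0 : M ≠ 0 := by omega
  rcases le_or_gt β 0 with hβ | hβ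
  · exact hχ.hasSpectralGap_of_nonpos hM0 𝒜 hβ
  have hM1 : (1 : ℝ) < M := by exact_mod_cast (show 1 < M by omega)
  set r : ℝ := (M : ℝ) ^ (-β) with hr
  have hr0 : 0 < r := by positivity
  have hr1 : r < 1 := Real.rpow_lt_one_of_one_lt_of_neg hM1 (by linarith)
  have key : ∀ s : ℝ, r < s → s < 1 →
      limsup (fun k : ℕ => spectralRadius ℂ (openQuantumMap M (M ^ k) 𝒜 χ)) atTop ≤
        ENNReal.ofReal s := by
    intro s hrs hs1
    obtain ⟨q, K, hqK⟩ := exists_scales hM hr0 hrs hs1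
    obtain ⟨C, hC0, hC⟩ := hχ.eigenvalue_le K
    refine limsup_le_of_le (h := ?_)
    filter_upwards [hqK C hC0] with k hk
    refine iSup₂_le fun z hz => ?_
    have hzs : ‖z‖ ≤ s := by
      by_contra! hcon
      obtain ⟨u, hu, hzu⟩ := exists_eigenvector hz
      have hz1 := (hχ.isContraction_openQuantumMap hM0 (pow_ne_zero k hM0) 𝒜).norm_eigenvalue_le
        hu hzu
      have h1 := hC M hM 𝒜 h𝒜 r hr0.le h k (k / q) ((Nat.div_le_self k q).trans (Nat.le_succ k)) z hz
      exact absurd h1 (not_le.2 (hk ‖z‖ hcon.le hz1))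
    have := ENNReal.ofReal_le_ofReal hzs
    rwa [ofReal_norm] at this
  unfold HasSpectralGap
  -- Let `s` decrease to `r`.
  refine ge_of_tendsto (x := 𝓝[>] r) (f := fun s => ENNReal.ofReal s)
    ((ENNReal.continuous_ofReal.tendsto r).mono_left nhdsWithin_le_nhds) ?_
  filter_upwards [Ioo_mem_nhdsGT hr1] with s hs
  exact key s hs.1 hs.2

/-! ### Concentration for sampling without replacement -/

/-- The Poisson weight `A ^ k / k!` is largest at `k = A`; this locates the binomial mode. -/
theorem Nat.pow_mul_factorial_le (A k : ℕ) : A ^ k * A.factorial ≤ A ^ A * k.factorial := by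
  rcases le_total A k with h | h
  · calc A ^ k * A.factorial = A ^ A * (A.factorial * A ^ (k - A)) := by
          rw [mul_left_comm, ← pow_add, Nat.add_sub_cancel' h, mul_comm]
      _ ≤ A ^ A * k.factorial := Nat.mul_le_mul_left _ (Nat.factorial_mul_pow_sub_le_factorial h)
  · have h1 := Nat.factorial_mul_descFactorial (Nat.sub_le A k)
    rw [Nat.sub_sub_self h] at h1
    calc A ^ k * A.factorial = A ^ k * (k.factorial * A.descFactorial (A - k)) := by rw [h1]
      _ ≤ A ^ k * (k.factorial * A ^ (A - k)) := by
          gcongr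
          exact Nat.descFactorial_le_pow _ _
      _ = A ^ A * k.factorial := by
          rw [mul_left_comm, ← pow_add, Nat.add_sub_cancel' h, mul_comm]

/-- The mode of the binomial distribution with mean `A` carries at least the average mass. -/
theorem Nat.pow_le_succ_mul_choose {M A : ℕ} (hA : A ≤ M) :
    M ^ M ≤ (M + 1) * (M.choose A * (A ^ A * (M - A) ^ (M - A))) := by
  obtain ⟨B, rfl⟩ := Nat.exists_eq_add_of_le hA
  rw [Nat.add_sub_cancel_left]
  rw [add_pow A B]
  refine (Finset.sum_le_card_nsmul _ _ _ fun k hk => ?_).trans_eq (by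
    rw [Finset.card_range, smul_eq_mul])
  have hk' : k ≤ A + B := Nat.lt_succ_iff.1 (Finset.mem_range.1 hk)
  have c1 := Nat.choose_mul_factorial_mul_factorial hk'
  have c2 := Nat.choose_mul_factorial_mul_factorial (Nat.le_add_right A B)
  rw [Nat.add_sub_cancel_left] at c2
  have h1 := Nat.pow_mul_factorial_le A k
  have h2 := Nat.pow_mul_factorial_le B (A + B - k)
  have hpos : 0 < A.factorial * B.factorial * (k.factorial * (A + B - k).factorial) := by
    positivity
  refine Nat.le_of_mul_le_mul_left ?_ hpos
  calc A.factorial * B.factorial * (k.factorial * (A + B - k).factorial) *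
        (A ^ k * B ^ (A + B - k) * (A + B).choose k)
      = ((A + B).choose k * k.factorial * (A + B - k).factorial) *
          ((A ^ k * A.factorial) * (B ^ (A + B - k) * B.factorial)) := by ring
    _ ≤ ((A + B).choose k * k.factorial * (A + B - k).factorial) *
          ((A ^ A * k.factorial) * (B ^ B * (A + B - k).factorial)) := by gcongr
    _ = _ := by rw [c1, ← c2]; ring

/-- Expanding the product sums over all subsets with unnormalized Bernoulli weights of parameter `A
/ M`; only those of size `A` are kept. -/
theorem sum_alphabets_prod_le {M A : ℕ} {g : Fin M → ℝ} (hg : ∀ j, 0 ≤ g j) :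
    (A : ℝ) ^ A * ((M - A : ℕ) : ℝ) ^ (M - A) * ∑ S ∈ alphabets M A, ∏ j ∈ S, g j ≤
      ∏ j, (A * g j + ((M - A : ℕ) : ℝ)) := by
  rw [Finset.prod_add, Finset.mul_sum]
  refine le_trans (le_of_eq ?_) (Finset.sum_le_sum_of_subset_of_nonneg
    (s := alphabets M A) (fun S _ => Finset.mem_powerset.2 (Finset.subset_univ S)) fun S _ _ => ?_)
  · refine Finset.sum_congr rfl fun S hS => ?_
    have hcard : S.card = A := (Finset.mem_powersetCard.1 hS).2
    rw [Finset.prod_mul_distrib, Finset.prod_const, Finset.prod_const, hcard,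
      Finset.card_sdiff_of_subset (Finset.subset_univ S), Finset.card_univ, Fintype.card_fin, hcard]
    ring
  · exact mul_nonneg (Finset.prod_nonneg fun j _ => mul_nonneg (by positivity) (hg j))
      (Finset.prod_nonneg fun _ _ => by positivity)

theorem card_alphabets (M A : ℕ) : (alphabets M A).card = M.choose A := by
  rw [alphabets, Finset.card_powersetCard, Finset.card_univ, Fintype.card_fin]

/-- Exponential moments for sampling without replacement. -/
theorem sum_alphabets_exp_le {M A : ℕ} (hA : 0 < A) (hAM : A < M) {f : Fin M → ℝ}
    (hf : ∀ j, |f j| ≤ 1) (hsum : ∑ j, f j = 0) {x : ℝ} (hx : |x| ≤ 1) :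
    ∑ S ∈ alphabets M A, Real.exp (x * ∑ j ∈ S, f j) ≤
      (alphabets M A).card * ((M + 1) * Real.exp (A * x ^ 2)) := by
  have hM0 : (0 : ℝ) < M := by exact_mod_cast hA.trans hAM
  have hA0 : (0 : ℝ) < A := by exact_mod_cast hA
  have hB0 : (0 : ℝ) < ((M - A : ℕ) : ℝ) := by exact_mod_cast Nat.sub_pos_of_lt hAM
  have hB : ((M - A : ℕ) : ℝ) = M - A := by rw [Nat.cast_sub hAM.le]
  set P : ℝ := (A : ℝ) ^ A * ((M - A : ℕ) : ℝ) ^ (M - A) with hP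
  have hP0 : 0 < P := by positivity
  have h1 := sum_alphabets_prod_le (A := A) (g := fun j => Real.exp (x * f j))
    fun j => (Real.exp_pos _).le
  have h2 : ∏ j : Fin M, (A * Real.exp (x * f j) + ((M - A : ℕ) : ℝ)) ≤
      (M : ℝ) ^ M * Real.exp (A * x ^ 2) := by
    calc ∏ j : Fin M, (A * Real.exp (x * f j) + ((M - A : ℕ) : ℝ))
        ≤ ∏ j : Fin M, (M * Real.exp (A / M * (x * f j + x ^ 2))) := by
          refine Finset.prod_le_prod (fun j _ => by positivity) fun j _ => ?_
          have hxf : |x * f j| ≤ 1 := by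
            rw [abs_mul]; exact mul_le_one₀ hx (abs_nonneg _) (hf j)
          have e1 := (abs_le.1 (Real.abs_exp_sub_one_sub_id_le hxf)).2
          have e2 : (x * f j) ^ 2 ≤ x ^ 2 := by
            rw [mul_pow]
            exact mul_le_of_le_one_right (sq_nonneg x) ((sq_le_one_iff_abs_le_one _).2 (hf j))
          have e3 := Real.add_one_le_exp (A / M * (x * f j + x ^ 2))
          calc A * Real.exp (x * f j) + ((M - A : ℕ) : ℝ)
              ≤ A * (1 + (x * f j + x ^ 2)) + ((M - A : ℕ) : ℝ) := by gcongr; linarith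
            _ = M * (A / M * (x * f j + x ^ 2) + 1) := by rw [hB]; field_simp; ring
            _ ≤ _ := by gcongr
      _ = (M : ℝ) ^ M * Real.exp (A * x ^ 2) := by
          rw [Finset.prod_mul_distrib, Finset.prod_const, Finset.card_univ, Fintype.card_fin,
            ← Real.exp_sum, ← Finset.mul_sum, Finset.sum_add_distrib, ← Finset.mul_sum, hsum,
            Finset.sum_const, Finset.card_univ, Fintype.card_fin, nsmul_eq_mul]
          congr 2
          field_simp
          ring
  -- Independent sampling has size exactly `A` with probability at least `1 / (M + 1)`, which is the
  -- price of conditioning.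
  have h3 : (M : ℝ) ^ M ≤ (M + 1) * ((alphabets M A).card * P) := by
    rw [card_alphabets, hP]
    exact_mod_cast Nat.pow_le_succ_mul_choose hAM.le
  have h4 : ∀ S : Finset (Fin M), Real.exp (x * ∑ j ∈ S, f j) = ∏ j ∈ S, Real.exp (x * f j) := by
    intro S
    rw [Finset.mul_sum, Real.exp_sum]
  simp only [h4]
  refine le_of_mul_le_mul_left ((h1.trans h2).trans ?_) hP0
  calc (M : ℝ) ^ M * Real.exp (A * x ^ 2)
      ≤ ((M + 1) * ((alphabets M A).card * P)) * Real.exp (A * x ^ 2) := by gcongr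
    _ = _ := by ring

theorem card_alphabets_filter_le {M A : ℕ} (hA : 0 < A) (hAM : A < M) {f : Fin M → ℝ}
    (hf : ∀ j, |f j| ≤ 1) (hsum : ∑ j, f j = 0) {u : ℝ} (hu : 0 ≤ u) :
    (((alphabets M A).filter fun S => u < ∑ j ∈ S, f j).card : ℝ) ≤
      (alphabets M A).card * ((M + 1) * Real.exp (-(u ^ 2 / (4 * A)))) := by
  have hA0 : (0 : ℝ) < A := by exact_mod_cast hA
  rcases le_or_gt u A with huA | huA
  -- The Chernoff parameter minimizing `A x ^ 2 - x u`, with minimum `-u ^ 2 / (4 A)`. For `u > A`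
  -- the event is empty.
  · set x : ℝ := u / (2 * A) with hx
    have hx0 : 0 ≤ x := by positivity
    have hx1 : |x| ≤ 1 := by
      rw [abs_of_nonneg hx0, hx, div_le_one (by positivity)]; linarith
    have h1 := sum_alphabets_exp_le hA hAM hf hsum hx1
    have h2 : (((alphabets M A).filter fun S => u < ∑ j ∈ S, f j).card : ℝ) * Real.exp (x * u) ≤
        ∑ S ∈ alphabets M A, Real.exp (x * ∑ j ∈ S, f j) := by
      refine le_trans ?_ (Finset.sum_le_sum_of_subset_of_nonneg
        (Finset.filter_subset (fun S => u < ∑ j ∈ S, f j) (alphabets M A))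
        fun _ _ _ => (Real.exp_pos _).le)
      rw [← nsmul_eq_mul]
      refine Finset.card_nsmul_le_sum _ _ _ fun S hS => ?_
      have := (Finset.mem_filter.1 hS).2
      exact Real.exp_le_exp.2 (mul_le_mul_of_nonneg_left this.le hx0)
    refine le_of_mul_le_mul_right ((h2.trans h1).trans_eq ?_) (Real.exp_pos (x * u))
    rw [mul_assoc, mul_assoc ((M : ℝ) + 1), ← Real.exp_add]
    congr 3
    rw [hx]
    field_simp
    ring
  · rw [Finset.filter_false_of_mem]
    · simp only [Finset.card_empty, Nat.cast_zero]
      positivity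
    · intro S hS
      have hcard : S.card = A := (Finset.mem_powersetCard.1 hS).2
      have : ∑ j ∈ S, f j ≤ S.card • (1 : ℝ) :=
        Finset.sum_le_card_nsmul _ _ _ fun j _ => (abs_le.1 (hf j)).2
      rw [hcard, nsmul_eq_mul, mul_one] at this
      linarith

/-! ### Random alphabets have small Fourier coefficients -/

/-- Alphabets all of whose nontrivial Fourier coefficients are at most `t`. -/
noncomputable def uniformAlphabets (M A : ℕ) (t : ℝ) : Finset (Finset (Fin M)) :=
  (alphabets M A).filter fun S => ∀ l l' : Fin M, l ≠ l' →
    ‖∑ j ∈ S, Complex.exp (-(2 * Real.pi * Complex.I * (j : ℕ) *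
      (((l : ℕ) - (l' : ℕ) : ℤ))) / (M : ℂ))‖ ≤ t

theorem card_large_coefficient_le {M A : ℕ} (hA : 0 < A) (hAM : A < M) {t : ℝ} (ht : 0 ≤ t)
    {d : ℤ} (hd : ¬ (M : ℤ) ∣ d) :
    (((alphabets M A).filter fun S : Finset (Fin M) => ¬ ‖∑ j ∈ S, Complex.exp (-(2 * Real.pi * Complex.I *
      (j : ℕ) * d) / (M : ℂ))‖ ≤ t).card : ℝ) ≤
      4 * ((alphabets M A).card * ((M + 1) * Real.exp (-(t ^ 2 / (16 * A))))) := by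
  set e : Fin M → ℂ := fun j => Complex.exp (-(2 * Real.pi * Complex.I * (j : ℕ) * d) / (M : ℂ))
    with he
  have hM0 : M ≠ 0 := by omega
  have hnorm : ∀ j, ‖e j‖ = 1 := fun j => by
    simpa using norm_exp_phase ((j : ℕ) : ℤ) d M
  have hzero : ∑ j, e j = 0 := sum_exp_eq_zero hM0 hd
  have hre : ∀ j, |(e j).re| ≤ 1 := fun j => (Complex.abs_re_le_norm _).trans (hnorm j).le
  have him : ∀ j, |(e j).im| ≤ 1 := fun j => (Complex.abs_im_le_norm _).trans (hnorm j).le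
  have hre0 : ∑ j, (e j).re = 0 := by rw [← Complex.re_sum, hzero, Complex.zero_re]
  have him0 : ∑ j, (e j).im = 0 := by rw [← Complex.im_sum, hzero, Complex.zero_im]
  have hu : 0 ≤ t / 2 := by linarith
  have b1 := card_alphabets_filter_le hA hAM hre hre0 hu
  have b2 := card_alphabets_filter_le hA hAM (f := fun j => -(e j).re)
    (by simpa only [abs_neg] using hre) (by rw [Finset.sum_neg_distrib, hre0, neg_zero]) hu
  have b3 := card_alphabets_filter_le hA hAM him him0 hu
  have b4 := card_alphabets_filter_le hA hAM (f := fun j => -(e j).im)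
    (by simpa only [abs_neg] using him) (by rw [Finset.sum_neg_distrib, him0, neg_zero]) hu
  have hexp : (t / 2) ^ 2 / (4 * A) = t ^ 2 / (16 * A) := by ring
  rw [hexp] at b1 b2 b3 b4
  set F1 := (alphabets M A).filter fun S => t / 2 < ∑ j ∈ S, (e j).re
  set F2 := (alphabets M A).filter fun S => t / 2 < ∑ j ∈ S, -(e j).re
  set F3 := (alphabets M A).filter fun S => t / 2 < ∑ j ∈ S, (e j).im
  set F4 := (alphabets M A).filter fun S => t / 2 < ∑ j ∈ S, -(e j).im
  -- If the norm exceeds `t`, one of the four signed real and imaginary parts exceeds `t / 2`.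
  have hsub : ((alphabets M A).filter fun S => ¬ ‖∑ j ∈ S, e j‖ ≤ t) ⊆ (F1 ∪ F2) ∪ (F3 ∪ F4) := by
    intro S hS
    obtain ⟨hSA, hSt⟩ := Finset.mem_filter.1 hS
    by_contra hcon
    simp only [F1, F2, F3, F4, Finset.mem_union, Finset.mem_filter, hSA, true_and, not_or, not_lt,
      Finset.sum_neg_distrib] at hcon
    obtain ⟨⟨c1, c2⟩, c3, c4⟩ := hcon
    refine hSt ((Complex.norm_le_abs_re_add_abs_im _).trans ?_)
    rw [Complex.re_sum, Complex.im_sum]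
    have := abs_le.2 ⟨by linarith, c1⟩
    have := abs_le.2 ⟨by linarith, c3⟩
    linarith
  have hcard : (((alphabets M A).filter fun S : Finset (Fin M) => ¬ ‖∑ j ∈ S, e j‖ ≤ t).card : ℝ) ≤
      (F1.card + F2.card) + (F3.card + F4.card) := by
    exact_mod_cast (Finset.card_le_card hsub).trans ((Finset.card_union_le _ _).trans
      (add_le_add (Finset.card_union_le _ _) (Finset.card_union_le _ _)))
  linarith

theorem alphabetProb_compl_uniformAlphabets_le {M A : ℕ} (hA : 0 < A) (hAM : A < M) {t : ℝ}
    (ht : 0 ≤ t) :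
    alphabetProb M A (alphabets M A \ uniformAlphabets M A t) ≤
      4 * M ^ 2 * (M + 1) * Real.exp (-(t ^ 2 / (16 * A))) := by
  have hcard0 : (0 : ℝ) < (alphabets M A).card := by
    rw [card_alphabets]; exact_mod_cast Nat.choose_pos hAM.le
  rw [alphabetProb, div_le_iff₀ hcard0]
  set bad : Fin M × Fin M → Finset (Finset (Fin M)) := fun p =>
    (alphabets M A).filter fun S => ¬ ‖∑ j ∈ S, Complex.exp (-(2 * Real.pi * Complex.I *
      (j : ℕ) * (((p.1 : ℕ) - (p.2 : ℕ) : ℤ))) / (M : ℂ))‖ ≤ t with hbad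
  have hsub : alphabets M A \ uniformAlphabets M A t ⊆
      (Finset.univ.filter fun p : Fin M × Fin M => p.1 ≠ p.2).biUnion bad := by
    intro S hS
    obtain ⟨hSA, hSu⟩ := Finset.mem_sdiff.1 hS
    simp only [uniformAlphabets, Finset.mem_filter, hSA, true_and, not_forall] at hSu
    obtain ⟨l, l', hne, h⟩ := hSu
    exact Finset.mem_biUnion.2 ⟨(l, l'), by simpa using hne, Finset.mem_filter.2 ⟨hSA, h⟩⟩
  have hb : ∀ p ∈ Finset.univ.filter fun p : Fin M × Fin M => p.1 ≠ p.2, ((bad p).card : ℝ) ≤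
      4 * ((alphabets M A).card * ((M + 1) * Real.exp (-(t ^ 2 / (16 * A))))) := by
    rintro ⟨l, l'⟩ hp
    refine card_large_coefficient_le hA hAM ht fun hd => (Finset.mem_filter.1 hp).2 ?_
    have h1 := l.2
    have h2 := l'.2
    have := Int.eq_zero_of_abs_lt_dvd hd (by rw [abs_lt]; constructor <;> simp only <;> omega)
    exact Fin.ext (by simp only at this ⊢; omega)
  have hbound0 : 0 ≤ 4 * ((alphabets M A).card * ((M + 1) * Real.exp (-(t ^ 2 / (16 * A))))) := by
    positivity
  calc ((alphabets M A \ uniformAlphabets M A t).card : ℝ)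
      ≤ ∑ p ∈ Finset.univ.filter fun p : Fin M × Fin M => p.1 ≠ p.2, ((bad p).card : ℝ) := by
        exact_mod_cast (Finset.card_le_card hsub).trans Finset.card_biUnion_le
    _ ≤ _ := Finset.sum_le_card_nsmul _ _ _ hb
    _ ≤ (M : ℝ) ^ 2 *
          (4 * ((alphabets M A).card * ((M + 1) * Real.exp (-(t ^ 2 / (16 * A)))))) := by
        rw [nsmul_eq_mul]
        refine mul_le_mul_of_nonneg_right ?_ hbound0
        have : (Finset.univ.filter fun p : Fin M × Fin M => p.1 ≠ p.2).card ≤ M ^ 2 := by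
          refine (Finset.card_filter_le _ _).trans_eq ?_
          rw [Finset.card_univ, Fintype.card_prod, Fintype.card_fin, sq]
        exact_mod_cast this
    _ = _ := by ring

theorem fourierBound_of_mem_uniformAlphabets {M A : ℕ} {t : ℝ} (ht : 0 ≤ t) {𝒜 : Finset (Fin M)}
    (h : 𝒜 ∈ uniformAlphabets M A t) :
    FourierBound M (digitSet M 𝒜) (digitSet M 𝒜) (Real.sqrt ((A + t * A) / M)) := by
  obtain ⟨h𝒜, hu⟩ := Finset.mem_filter.1 h
  have hinj : Function.Injective fun a : Fin M => ((a : ℕ) : ℤ) :=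
    fun a b hab => Fin.ext (by simpa using hab)
  have hcard : (digitSet M 𝒜).card = A := by
    rw [digitSet, Finset.card_image_of_injective _ hinj, (Finset.mem_powersetCard.1 h𝒜).2]
  rw [← hcard]
  refine FourierBound.of_decay ht ?_
  intro l hl l' hl' hne
  obtain ⟨a, -, rfl⟩ := Finset.mem_image.1 hl
  obtain ⟨a', -, rfl⟩ := Finset.mem_image.1 hl'
  rw [digitSet, Finset.sum_image hinj.injOn]
  simpa only [Int.cast_natCast] using hu a a' fun h => hne (by rw [h])

theorem bounds_of_dimension_mem_Ioo {M A : ℕ} (hM : 3 ≤ M) (h : dimension M A ∈ Set.Ioo (0 : ℝ) 1) :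
    2 ≤ A ∧ A < M ∧ (A : ℝ) = (M : ℝ) ^ dimension M A := by
  have hM1 : (1 : ℝ) < M := by exact_mod_cast (show 1 < M by omega)
  have hlM : 0 < Real.log M := Real.log_pos hM1
  obtain ⟨h0, h1⟩ := h
  rw [dimension] at h0 h1 ⊢
  have hA : 2 ≤ A := by
    by_contra! hA
    interval_cases A <;> simp at h0
  have hA0 : (0 : ℝ) < A := by positivity
  refine ⟨hA, ?_, ?_⟩
  · rw [div_lt_one hlM] at h1
    exact_mod_cast (Real.log_lt_log_iff hA0 (by linarith)).1 h1
  · rw [Real.rpow_def_of_pos (by linarith), mul_div_cancel₀ _ hlM.ne', Real.exp_log hA0]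

theorem two_le_log_four_mul {M : ℕ} (hM : 3 ≤ M) : 2 ≤ Real.log (4 * M) := by
  have hM' : (3 : ℝ) ≤ M := by exact_mod_cast hM
  rw [Real.le_log_iff_exp_le (by positivity)]
  have h1 := Real.exp_one_lt_d9
  have h2 : Real.exp 2 = Real.exp 1 * Real.exp 1 := by rw [← Real.exp_add]; norm_num
  have h3 := Real.exp_pos 1
  rw [h2]
  nlinarith

theorem exists_alphabets_spectralGap {M A : ℕ} (hM : 3 ≤ M)
    (hδ : dimension M A ∈ Set.Ioo (0 : ℝ) 1) {ε : ℝ} :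
    ∃ G : Finset (Finset (Fin M)), G ⊆ alphabets M A ∧
      alphabetProb M A (alphabets M A \ G)
        ≤ 4 * (M : ℝ) * Real.exp (-((M : ℝ) ^ (4 * ε) / 64)) ∧
      ∀ 𝒜 ∈ G, ∀ χ : ℝ → ℝ, IsCutoff χ →
        HasSpectralGap M 𝒜 χ (1 / 2 - 3 / 4 * dimension M A - ε) := by
  obtain ⟨hA2, hAM, hAδ⟩ := bounds_of_dimension_mem_Ioo hM hδ
  have hM0 : (0 : ℝ) < M := by positivity
  have hM3 : (3 : ℝ) ≤ M := by exact_mod_cast hM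
  have hA0 : (0 : ℝ) < A := by positivity
  set δ := dimension M A
  set s : ℝ := (M : ℝ) ^ (2 * ε) with hs
  have hs0 : 0 < s := by positivity
  have hs2 : (M : ℝ) ^ (4 * ε) = s ^ 2 := by
    rw [hs, ← Real.rpow_natCast, ← Real.rpow_mul hM0.le]; congr 1; push_cast; ring
  rw [hs2]
  -- If the claimed bound is at least `1` it is vacuous and the empty set serves. Otherwise `s ^ 2 >
  -- 64 log (4 M) ≥ 128`, which makes `s` large.
  rcases le_or_gt 1 (4 * (M : ℝ) * Real.exp (-(s ^ 2 / 64))) with h1 | h1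
  · refine ⟨∅, Finset.empty_subset _, ?_, by simp⟩
    rw [Finset.sdiff_empty, alphabetProb]
    exact (div_self_le_one _).trans h1
  have hlog : 64 * Real.log (4 * M) ≤ s ^ 2 := by
    have h2 : (4 : ℝ) * M < Real.exp (s ^ 2 / 64) := by
      rw [Real.exp_neg] at h1
      have := (mul_inv_lt_iff₀ (Real.exp_pos (s ^ 2 / 64))).1 h1
      linarith
    have := (Real.log_lt_iff_lt_exp (by positivity)).2 h2
    linarith
  have hlog2 := two_le_log_four_mul hM
  have hs8 : 8 ≤ s := by nlinarith
  have hsA : 1 ≤ Real.sqrt A := Real.one_le_sqrt.2 (by exact_mod_cast (by omega : 1 ≤ A))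
  have hsqA : Real.sqrt A ^ 2 = A := Real.sq_sqrt hA0.le
  have hAs : 8 ≤ Real.sqrt A * s := by nlinarith
  -- The `- 1` makes `A + t A` exactly `A ^ (3/2) * s`, hence the Fourier bound exactly the required
  -- power of `M`.
  set t : ℝ := Real.sqrt A * s - 1 with ht
  have ht0 : 0 ≤ t := by linarith
  -- From `t ≥ (7/8) √A s` and `49/1024 ≥ 3/64`. One third of the exponent is the claimed decay; the
  -- other two thirds give `(4 M) ^ (-2)`, absorbing the union bound.
  have ht2 : 3 / 64 * s ^ 2 ≤ t ^ 2 / (16 * A) := by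
    rw [le_div_iff₀ (by positivity)]
    have h7 : 7 / 8 * (Real.sqrt A * s) ≤ t := by linarith
    have h8 := pow_le_pow_left₀ (by positivity) h7 2
    have h9 : (7 / 8 * (Real.sqrt A * s)) ^ 2 = 49 / 64 * (A * s ^ 2) := by
      rw [mul_pow, mul_pow, hsqA]; ring
    have h10 : 0 ≤ A * s ^ 2 := by positivity
    linarith
  refine ⟨uniformAlphabets M A t, Finset.filter_subset _ _, ?_, ?_⟩
  · refine (alphabetProb_compl_uniformAlphabets_le (by omega) hAM ht0).trans ?_
    have e1 : Real.exp (-(t ^ 2 / (16 * A))) ≤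
        Real.exp (-(s ^ 2 / 64)) * Real.exp (-(2 * Real.log (4 * M))) := by
      rw [← Real.exp_add]
      exact Real.exp_le_exp.2 (by linarith)
    have e2 : Real.exp (-(2 * Real.log (4 * M))) = 1 / (16 * M ^ 2) := by
      rw [Real.exp_neg, two_mul, Real.exp_add, Real.exp_log (by positivity)]
      field_simp
      norm_num
    rw [e2] at e1
    calc 4 * (M : ℝ) ^ 2 * (M + 1) * Real.exp (-(t ^ 2 / (16 * A)))
        ≤ 4 * (M : ℝ) ^ 2 * (M + 1) * (Real.exp (-(s ^ 2 / 64)) * (1 / (16 * M ^ 2))) := by gcongr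
      _ = ((M + 1) / 4) * Real.exp (-(s ^ 2 / 64)) := by field_simp; ring
      _ ≤ 4 * M * Real.exp (-(s ^ 2 / 64)) := by gcongr; linarith
  · intro 𝒜 h𝒜 χ hχ
    have hcard : 𝒜.card = A := (Finset.mem_powersetCard.1 (Finset.mem_filter.1 h𝒜).1).2
    refine hχ.hasSpectralGap_of_fourierBound (by omega) (Finset.card_pos.1 (by omega)) ?_
    have := fourierBound_of_mem_uniformAlphabets ht0 h𝒜
    convert this using 1
    symm
    rw [Real.sqrt_eq_iff_mul_self_eq (by positivity) (by positivity), ← Real.rpow_add hM0]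
    have e1 : (A : ℝ) + t * A = A * Real.sqrt A * s := by rw [ht]; ring
    rw [e1, hs, Real.sqrt_eq_rpow, hAδ, ← Real.rpow_mul hM0.le, ← Real.rpow_add hM0,
      ← Real.rpow_add hM0, ← Real.rpow_sub_one hM0.ne']
    congr 1
    ring

/-! ### The expected spectral gap -/

theorem IsCutoff.spectralGap_nonneg {χ : ℝ → ℝ} (hχ : IsCutoff χ) {M : ℕ} (hM : M ≠ 0)
    (𝒜 : Finset (Fin M)) : 0 ≤ spectralGap M 𝒜 χ :=
  le_sSup ⟨0, hχ.hasSpectralGap_of_nonpos hM 𝒜 le_rfl, by simp⟩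

theorem alphabetExpectation_ge {M A : ℕ} {X : Finset (Fin M) → EReal} (hX : ∀ 𝒜, 0 ≤ X 𝒜)
    {G : Finset (Finset (Fin M))} (hG : G ⊆ alphabets M A) {b : ℝ} (hb : ∀ 𝒜 ∈ G, (b : EReal) ≤ X 𝒜) :
    ((b * (G.card / (alphabets M A).card) : ℝ) : EReal) ≤ alphabetExpectation M A X := by
  have hsum : ((b * G.card : ℝ) : EReal) ≤ ∑ 𝒜 ∈ alphabets M A, X 𝒜 := by
    calc ((b * G.card : ℝ) : EReal) = ∑ 𝒜 ∈ G, (b : EReal) := by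
          rw [Finset.sum_const, ← EReal.coe_nsmul, nsmul_eq_mul, mul_comm]
      _ ≤ ∑ 𝒜 ∈ G, X 𝒜 := Finset.sum_le_sum hb
      _ ≤ ∑ 𝒜 ∈ alphabets M A, X 𝒜 :=
          Finset.sum_le_sum_of_subset_of_nonneg hG fun 𝒜 _ _ => hX 𝒜
  rw [← mul_div_assoc, EReal.coe_div]
  exact EReal.div_le_div_right_of_nonneg (by exact_mod_cast Nat.cast_nonneg _) hsum

theorem tendsto_log_log_div_log :
    Tendsto (fun M : ℕ => Real.log (128 * Real.log (4 * M)) / (4 * Real.log M)) atTop (𝓝 0) := by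
  have hlogM : Tendsto (fun M : ℕ => Real.log M) atTop atTop :=
    Real.tendsto_log_atTop.comp tendsto_natCast_atTop_atTop
  have h1 : Tendsto (fun y : ℝ => (Real.log 384 + Real.log y) / (4 * y)) atTop (𝓝 0) := by
    have a := (tendsto_inv_atTop_zero (𝕜 := ℝ)).const_mul (Real.log 384 / 4)
    have b := (Real.isLittleO_log_id_atTop.tendsto_div_nhds_zero).const_mul (1 / 4)
    have c := a.add b
    simp only [mul_zero, add_zero, id_eq] at c
    refine c.congr fun y => ?_
    ring
  refine squeeze_zero' ?_ ?_ (h1.comp hlogM)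
  · filter_upwards [eventually_ge_atTop 3] with M hM
    have h2 := two_le_log_four_mul hM
    exact div_nonneg (Real.log_nonneg (by linarith))
      (mul_nonneg (by norm_num) (Real.log_natCast_nonneg M))
  · filter_upwards [eventually_ge_atTop 3] with M hM
    have h2 := two_le_log_four_mul hM
    have hM3 : (3 : ℝ) ≤ M := by exact_mod_cast hM
    have hl : 0 < Real.log M := Real.log_pos (by linarith)
    have h3 : Real.log (4 * M) ≤ 3 * Real.log M := by
      rw [← Real.log_rpow (by linarith)]
      refine Real.log_le_log (by positivity) ?_
      have : (M : ℝ) ^ (3 : ℝ) = M ^ 3 := by exact_mod_cast Real.rpow_natCast (M : ℝ) 3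
      rw [this]
      nlinarith [mul_nonneg (by linarith : (0 : ℝ) ≤ M) (by nlinarith : (0 : ℝ) ≤ (M : ℝ) ^ 2 - 4)]
    simp only [Function.comp_apply]
    rw [← Real.log_mul (by norm_num) hl.ne']
    refine div_le_div_of_nonneg_right (Real.log_le_log (by linarith) (by linarith)) (by linarith)

theorem mainTheorem3 :
    (∀ M A : ℕ, 3 ≤ M → dimension M A ∈ Set.Ioo (0 : ℝ) (2 / 3) →
      ∀ ε : ℝ, 0 < ε →
        ∃ G : Finset (Finset (Fin M)), G ⊆ alphabets M A ∧
          alphabetProb M A (alphabets M A \ G)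
            ≤ 4 * (M : ℝ) * Real.exp (-((M : ℝ) ^ (4 * ε) / 64)) ∧
          ∀ 𝒜 ∈ G, ∀ χ : ℝ → ℝ, IsCutoff χ →
            HasSpectralGap M 𝒜 χ (1 / 2 - 3 / 4 * dimension M A - ε)) ∧
    (∃ o : ℕ → ℝ, Tendsto o atTop (𝓝 0) ∧
      ∀ M A : ℕ, 3 ≤ M → dimension M A ∈ Set.Ioo (0 : ℝ) 1 →
        ∀ χ : Finset (Fin M) → ℝ → ℝ, (∀ 𝒜, IsCutoff (χ 𝒜)) →
          ((max 0 (1 / 2 - 3 / 4 * dimension M A + o M) : ℝ) : EReal)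
            ≤ alphabetExpectation M A (fun 𝒜 => spectralGap M 𝒜 (χ 𝒜))) := by
  constructor
  · intro M A hM hδ ε _
    exact exists_alphabets_spectralGap hM ⟨hδ.1, hδ.2.trans (by norm_num)⟩
  -- This `ε` makes `M ^ (4 ε) = 128 log (4 M)`, so the exceptional probability is at most `4 M (4
  -- M) ^ (-2) = 1 / (4 M)`. Since `b ≤ 1`, discarding the exceptional alphabets costs at most
  -- another `1 / (4 M)`.
  set e : ℕ → ℝ := fun M => Real.log (128 * Real.log (4 * M)) / (4 * Real.log M) with he
  refine ⟨fun M => -(e M + 1 / (4 * M)), ?_, ?_⟩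
  · have h1 := tendsto_log_log_div_log.add (tendsto_one_div_atTop_nhds_zero_nat.const_mul (1 / 4))
    have h2 := h1.neg
    simp only [mul_zero, add_zero, neg_zero] at h2
    refine h2.congr fun M => ?_
    simp only [he]
    ring
  · intro M A hM hδ χ hχ
    obtain ⟨hA2, hAM, -⟩ := bounds_of_dimension_mem_Ioo hM hδ
    have hM0 : (0 : ℝ) < M := by positivity
    have hM3 : (3 : ℝ) ≤ M := by exact_mod_cast hM
    have hl : 0 < Real.log M := Real.log_pos (by linarith)
    have hl4 := two_le_log_four_mul hM
    have hcard0 : (0 : ℝ) < (alphabets M A).card := by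
      rw [card_alphabets]; exact_mod_cast Nat.choose_pos hAM.le
    obtain ⟨G, hGA, hGp, hGgap⟩ := exists_alphabets_spectralGap hM hδ (ε := e M)
    have he0 : 0 ≤ e M := div_nonneg (Real.log_nonneg (by linarith)) (by linarith)
    have hpow : (M : ℝ) ^ (4 * e M) = 128 * Real.log (4 * M) := by
      rw [Real.rpow_def_of_pos hM0, he]
      have : Real.log M * (4 * (Real.log (128 * Real.log (4 * M)) / (4 * Real.log M))) =
          Real.log (128 * Real.log (4 * M)) := by field_simp
      simp only [this]
      exact Real.exp_log (by linarith)
    have hprob : alphabetProb M A (alphabets M A \ G) ≤ 1 / (4 * M) := by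
      refine hGp.trans_eq ?_
      rw [hpow, show 128 * Real.log (4 * M) / 64 = Real.log (4 * M) + Real.log (4 * M) by ring,
        Real.exp_neg, Real.exp_add, Real.exp_log (by positivity)]
      field_simp
    have hG : 1 - 1 / (4 * M) ≤ (G.card : ℝ) / (alphabets M A).card := by
      rw [alphabetProb, Finset.card_sdiff_of_subset hGA, Nat.cast_sub (Finset.card_le_card hGA),
        sub_div, div_self hcard0.ne'] at hprob
      linarith
    set b : ℝ := 1 / 2 - 3 / 4 * dimension M A - e M with hb
    have hb1 : b ≤ 1 := by linarith [hδ.1]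
    refine le_trans ?_ (alphabetExpectation_ge (b := max 0 b)
      (fun 𝒜 => (hχ 𝒜).spectralGap_nonneg (by omega) 𝒜) hGA fun 𝒜 h𝒜 => ?_)
    · rw [EReal.coe_le_coe_iff]
      have hM4 : 1 / (4 * (M : ℝ)) ≤ 1 := by
        rw [div_le_one (by positivity)]; linarith
      refine le_trans ?_ (mul_le_mul_of_nonneg_left hG (le_max_left 0 b))
      have hM4' : 0 ≤ 1 / (4 * (M : ℝ)) := by positivity
      refine max_le (mul_nonneg (le_max_left _ _) (by linarith)) ?_
      have h1 : max 0 b * (1 / (4 * (M : ℝ))) ≤ 1 / (4 * (M : ℝ)) :=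
        mul_le_of_le_one_left hM4' (max_le zero_le_one hb1)
      have h2 := le_max_right 0 b
      linarith
    · rcases le_total 0 b with h | h
      · rw [max_eq_right h]
        exact le_sSup ⟨b, hGgap 𝒜 h𝒜 _ (hχ 𝒜), rfl⟩
      · rw [max_eq_left h]
        exact (hχ 𝒜).spectralGap_nonneg (by omega) 𝒜
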